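/- All monoids are commutative and cancellative. Let $H$ be a Krull monoid and $\varphi\colon H\to\mathcal F(P)$ a cofinal divisor homomorphism into the free abelian monoid with basis $P$ (that is, $\varphi(a)\mid\varphi(b)$ implies $a\mid b$, and every element of $\mathcal F(P)$ divides some $\varphi(u)$, $u \in H$), and suppose that the class group $G=\mathcal C(\varphi)=\mathsf q(\mathcal F(P))/\mathsf q(\varphi(H))$ is infinite cyclic, identified with $\mathbb Z$. Let $G_P=\{[p]\mid p\in P\}\subset\mathbb Z$ be the set of classes containing prime divisors and suppose that $G_P^-=\{g\in G_P\mid g<0\}$ is finite. *Notation.* Sequences are elements of free abelian monoids $\mathcal F(G_0)$, $G_0\subset\mathbb Z$; $\sigma(S)$ is the sum of the terms of $S$, and $S^+$ is the subsequence of its positive terms. $\mathcal B(G_0)=\{S\in\mathcal F(G_0)\mid\sigma(S)=0\}$, and $\mathcal A(\cdot)$ denotes the set of atoms. $\boldsymbol\beta\colon H\to\mathcal B(G_P)$ is the block homomorphism: $\boldsymbol\beta(a)=[p_1]\cdots[p_l]$ if $\varphi(a)=p_1\cdots p_l$. For $a$ in a monoid, $\mathsf Z(a)$ is the set of factorizations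 of $a$, i.e. of formal products of atoms of the associated reduced monoid whose product is the class of $a$; $|z|$ is the number of atoms in $z$, and $\mathsf d(z,z')=\max\{|z\gcd(z,z')^{-1}|,|z'\gcd(z,z')^{-1}|\}$. $\overline{\boldsymbol\beta}\colon\mathsf Z(H)\to\mathsf Z(\mathcal B(G_P))$ is the homomorphism of factorization monoids induced by $\boldsymbol\beta$. For $B\in\mathcal B(G_P)$ and $z=A_1\cdots A_n\in\mathsf Z(B)$ with atoms $A_i$, let $z^+=A_1^+\cdots A_n^+$, a formal product of sequences. For $z,y\in\mathsf Z(B)$ write $z^+\le y^+$ if $y$ can be written as $y=\prod_{j=1}^n\bigl(B_{j,1}\cdots B_{j,k_j}\bigr)$ with atoms $B_{j,i}$ such that $A_j^+=B_{j,1}^+\cdots B_{j,k_j}^+$ as sequences, for all $j\in[1,n]$. Let $\Upsilon(B)$ be the set of those $z\in\mathsf Z(B)$ for which $z^+$ is maximal in $\{y^+\mid y\in\mathsf Z(B)\}$ with respect to this partial order, and for $a\in H$ let $\Upsilon(a)=\{z\in\mathsf Z(a)\mid\overline{\boldsymbol\beta}(z)\in\Upsilon(\boldsymbol\beta(a))\}$.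 Let $\mathcal E=\{(S_1,S_2)\in\mathcal F(G_P^-)^2\mid\sigma(S_1)=\sigma(S_2)\}$ and $\mathcal S=\{(S_1,S_2)\in\mathcal F(G_P^-)^2\mid S_1=S_2\}$, and let $\mathsf D(\mathcal S,\mathcal E)$ be the relative Davenport constant: the least $N\in\mathbb N\cup\{\infty\}$ such that every nontrivial formal product $z$ of atoms of $\mathcal E$ whose product lies in $\mathcal S$ has a nontrivial divisor $z'$ with $|z'|\le N$ whose product lies in $\mathcal S$. **Theorem.** Let $a\in H$ and $M=|\min(\operatorname{supp}(\boldsymbol\beta(a)))|$ (with $M=0$ if $\boldsymbol\beta(a)$ is the empty sequence). 1. $\max\{M\cdot\mathsf D(\mathcal S,\mathcal E),2\}<\infty$, and for every $z\in\mathsf Z(a)$ there exist $y\in\Upsilon(a)$ and a chain $z=z_0,\dots,z_r=y$ of factorizations of $a$ such that, for all $i\in[0,r-1]$, $$|z_i|\le|z_{i+1}|,\qquad \mathsf d(z_i,z_{i+1})\le\max\{M\cdot\mathsf D(\mathcal S,\mathcal E),2\}\qquad\text{and}\qquad \overline{\boldsymbol\beta}(z_i)^+\le\overline{\boldsymbol\beta}(z_{i+1})^+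 .$$ 2. $\max\{\mathsf D(\mathcal S,\mathcal E),2\}<\infty$, and for any $z,y\in\Upsilon(a)$ with $\overline{\boldsymbol\beta}(z)^+=\overline{\boldsymbol\beta}(y)^+$ there is a chain $z=z_0,\dots,z_r=y$ of factorizations of $a$ such that $\overline{\boldsymbol\beta}(z_i)^+=\overline{\boldsymbol\beta}(z)^+=\overline{\boldsymbol\beta}(y)^+$ and $|z_i|=|z|=|y|$ for all $i\in[0,r]$, and $\mathsf d(z_i,z_{i+1})\le\max\{\mathsf D(\mathcal S,\mathcal E),2\}$ for all $i\in[0,r-1]$. -/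

import Mathlib

namespace KrullChain

/-! ### Divisor homomorphisms, class groups and prime classes

All monoids are commutative and cancellative. The free abelian monoid with basis `P` is
`Multiset P` (written additively); for homomorphisms out of the multiplicative monoid `H` we use
`Multiplicative (Multiset P)`. -/

section ClassGroups

variable {H D : Type*} [CommMonoid H] [CommMonoid D]

/-- `φ` is a divisor homomorphism: `φ a ∣ φ b` implies `a ∣ b`. -/
def IsDivisorHom (φ : H →* D) : Prop :=
  ∀ a b : H, φ a ∣ φ b → a ∣ b

/-- `φ` is cofinal: every element of `D` divides some `φ u`. -/
def IsCofinalHom (φ : H →* D) : Prop :=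
  ∀ x : D, ∃ u : H, x ∣ φ u

/-- The class group `𝒞(φ) = q(D) / q(φ(H))`, where `q(D)` is the quotient group of `D` and
`q(φ(H))` is the subgroup of `q(D)` generated by `φ(H)`. -/
abbrev ClassGp (φ : H →* D) : Type _ :=
  Algebra.GrothendieckGroup D ⧸
    Subgroup.closure (Set.range fun a : H => Algebra.GrothendieckGroup.of (φ a))

/-- The class `[x] ∈ 𝒞(φ)` containing `x ∈ D`. -/
def cls (φ : H →* D) (x : D) : ClassGp φ :=
  QuotientGroup.mk (Algebra.GrothendieckGroup.of x)

end ClassGroups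

section Block

variable {H P : Type*} [CommMonoid H] (φ : H →* Multiplicative (Multiset P))
  (ι : ClassGp φ ≃* Multiplicative ℤ)

/-- The class `[p]` of `p ∈ P`, seen as an integer through the identification `ι : 𝒞(φ) ≃ ℤ`. -/
def primeClass (p : P) : ℤ :=
  (ι (cls φ (Multiplicative.ofAdd {p}))).toAdd

/-- `G_P`, the set of classes containing prime divisors, as a set of integers. -/
def primeClasses : Set ℤ :=
  Set.range (primeClass φ ι)

/-- The block homomorphism `β`: write `φ(a) = p₁ ⋯ pₗ`, then `β(a) = [p₁] ⋯ [pₗ]`. -/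
def block (a : H) : Multiset ℤ :=
  (φ a).toAdd.map (primeClass φ ι)

theorem block_eq_of_associated {a b : H} (h : Associated a b) : block φ ι a = block φ ι b := by
  obtain ⟨u, rfl⟩ := h
  have h1 : φ (u : H) * φ ((u⁻¹ : Hˣ) : H) = 1 := by
    rw [← map_mul, Units.mul_inv, map_one]
  have h2 : (φ (u : H)).toAdd + (φ ((u⁻¹ : Hˣ) : H)).toAdd = 0 := congrArg Multiplicative.toAdd h1
  have h3 : (φ (u : H)).toAdd = 0 := (add_eq_zero.mp h2).1
  simp [block, h3]

/-- The map `H_red → ℱ(G_P)` induced by `β`, where `H_red = Associates H`. -/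
def blockRed : Associates H → Multiset ℤ :=
  Quotient.lift (block φ ι) fun _ _ h => block_eq_of_associated φ ι h

/-- The extension `β̄ : Z(H) → Z(ℬ(G_P))` of `β` to factorizations (`ℬ(G_P)` is reduced). -/
def blockFact (z : Multiset (Associates H)) : Multiset (Multiset ℤ) :=
  z.map (blockRed φ ι)

end Block

/-! ### Factorizations in a monoid -/

/-- `Z(a)`: the set of factorizations of `a`, that is the formal products (multisets) of atoms of
`H_red` whose product is the class of `a`. The length `|z|` is `Multiset.card z`. -/
def factorizations {H : Type*} [CommMonoid H] (a : H) : Set (Multiset (Associates H)) :=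
  {z | (∀ u ∈ z, Irreducible u) ∧ z.prod = Associates.mk a}

open Classical in
/-- The distance `d(z, z') = max {|z gcd(z,z')⁻¹|, |z' gcd(z,z')⁻¹|}`
(`z - z'` is `z` with the common part of `z` and `z'` removed). -/
noncomputable def dist {α : Type*} (z z' : Multiset α) : ℕ :=
  max (Multiset.card (z - z')) (Multiset.card (z' - z))

/-- The atoms of a submonoid `M` of an additively written monoid. -/
def atoms {D : Type*} [AddCommMonoid D] (M : AddSubmonoid D) : Set D :=
  {x | ∃ h : x ∈ M, AddIrreducible (⟨x, h⟩ : M)}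

/-! ### Zero-sum sequences over sets of integers -/

/-- `ℱ(G₀)`: sequences (multisets) with terms in `G₀`. -/
def seqs (G₀ : Set ℤ) : AddSubmonoid (Multiset ℤ) where
  carrier := {S | ∀ g ∈ S, g ∈ G₀}
  zero_mem' := by simp
  add_mem' := by
    intro S T hS hT g hg
    rcases Multiset.mem_add.mp hg with h | h
    · exact hS g h
    · exact hT g h

/-- `ℬ(G₀)`: the monoid of zero-sum sequences over `G₀`. -/
def zeroSumSeqs (G₀ : Set ℤ) : AddSubmonoid (Multiset ℤ) where
  carrier := {S | S ∈ seqs G₀ ∧ S.sum = 0}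
  zero_mem' := ⟨(seqs G₀).zero_mem, by simp⟩
  add_mem' := by
    rintro S T ⟨hS, hS'⟩ ⟨hT, hT'⟩
    exact ⟨(seqs G₀).add_mem hS hT, by simp [hS', hT']⟩

/-- `Z(B)` for `B ∈ ℬ(G₀)`: formal products of atoms of the (reduced) monoid `ℬ(G₀)` with
product `B`. -/
def seqFactorizations (G₀ : Set ℤ) (B : Multiset ℤ) : Set (Multiset (Multiset ℤ)) :=
  {z | (∀ U ∈ z, U ∈ atoms (zeroSumSeqs G₀)) ∧ z.sum = B}

/-- `S⁺`: the subsequence of positive terms of `S`. -/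
def posSeq (S : Multiset ℤ) : Multiset ℤ :=
  S.filter fun g => 0 < g

/-- `z⁺ = A₁⁺ ⋯ Aₙ⁺`, a formal product of sequences, for `z = A₁ ⋯ Aₙ`. -/
def posFact (z : Multiset (Multiset ℤ)) : Multiset (Multiset ℤ) :=
  z.map posSeq

/-- The refinement order on positive parts: for `p = A₁⁺ ⋯ Aₙ⁺`, we have `p ≤ q` when `q` is the
formal product of `n` blocks `B_{j,1}⁺, …, B_{j,k_j}⁺` (`1 ≤ j ≤ n`) with
`A_j⁺ = B_{j,1}⁺ ⋯ B_{j,k_j}⁺` in `ℱ(ℤ)` for every `j`. Here `w` is the collection of blocks. -/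
def PosLE (p q : Multiset (Multiset ℤ)) : Prop :=
  ∃ w : Multiset (Multiset (Multiset ℤ)), w.map Multiset.sum = p ∧ w.sum = q

/-- `Υ(B)`: the factorizations `z ∈ Z(B)` such that `z⁺` is maximal in
`Z(B)⁺ = {y⁺ ∣ y ∈ Z(B)}`. -/
def upsilonSeq (G₀ : Set ℤ) (B : Multiset ℤ) : Set (Multiset (Multiset ℤ)) :=
  {z | z ∈ seqFactorizations G₀ B ∧
    ∀ y ∈ seqFactorizations G₀ B, PosLE (posFact z) (posFact y) → posFact y = posFact z}

/-- `Υ(a) = {z ∈ Z(a) ∣ β̄(z) ∈ Υ(β(a))}`. -/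
def upsilon {H P : Type*} [CommMonoid H] (φ : H →* Multiplicative (Multiset P))
    (ι : ClassGp φ ≃* Multiplicative ℤ) (a : H) : Set (Multiset (Associates H)) :=
  {z | z ∈ factorizations a ∧ blockFact φ ι z ∈ upsilonSeq (primeClasses φ ι) (block φ ι a)}

/-! ### The relative Davenport constant -/

/-- `ℰ(G₀)`: the pairs of sequences over `G₀` with equal sums. -/
def equalSumPairs (G₀ : Set ℤ) : AddSubmonoid (Multiset ℤ × Multiset ℤ) where
  carrier := {T | T.1 ∈ seqs G₀ ∧ T.2 ∈ seqs G₀ ∧ T.1.sum = T.2.sum}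
  zero_mem' := ⟨(seqs G₀).zero_mem, (seqs G₀).zero_mem, rfl⟩
  add_mem' := by
    rintro S T ⟨hS1, hS2, hS⟩ ⟨hT1, hT2, hT⟩
    exact ⟨(seqs G₀).add_mem hS1 hT1, (seqs G₀).add_mem hS2 hT2, by simp [hS, hT]⟩

/-- `𝒮(G₀)`: the symmetric pairs `(S, S)` of sequences over `G₀`. -/
def symmPairs (G₀ : Set ℤ) : AddSubmonoid (Multiset ℤ × Multiset ℤ) where
  carrier := {T | T.1 ∈ seqs G₀ ∧ T.2 ∈ seqs G₀ ∧ T.1 = T.2}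
  zero_mem' := ⟨(seqs G₀).zero_mem, (seqs G₀).zero_mem, rfl⟩
  add_mem' := by
    rintro S T ⟨hS1, hS2, hS⟩ ⟨hT1, hT2, hT⟩
    exact ⟨(seqs G₀).add_mem hS1 hT1, (seqs G₀).add_mem hS2 hT2, by simp [hS, hT]⟩

/-- The relative Davenport constant `D(S, E)` of submonoids `S ⊆ E` (with `E` reduced): the least
`N ∈ ℕ ∪ {∞}`, `N ≥ 1`, such that every nontrivial formal product `z` of atoms of `E` with
`π(z) ∈ S` has a nontrivial divisor `z'` with `π(z') ∈ S` and `|z'| ≤ N`. -/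
noncomputable def relDavenport {D : Type*} [AddCommMonoid D] (S E : AddSubmonoid D) : ℕ∞ :=
  sInf {N : ℕ∞ | 1 ≤ N ∧ ∀ z : Multiset D, z ≠ 0 → (∀ u ∈ z, u ∈ atoms E) → z.sum ∈ S →
    ∃ z' ≤ z, z' ≠ 0 ∧ z'.sum ∈ S ∧ (Multiset.card z' : ℕ∞) ≤ N}

/-- `L⁻`: the negative elements of a set of integers. -/
def negPart (L : Set ℤ) : Set ℤ :=
  {g | g ∈ L ∧ g < 0}

/-- `D(𝒮(G_P⁻), ℰ(G_P⁻))`. -/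
noncomputable def davenportSE {H P : Type*} [CommMonoid H]
    (φ : H →* Multiplicative (Multiset P)) (ι : ClassGp φ ≃* Multiplicative ℤ) : ℕ∞ :=
  relDavenport (symmPairs (negPart (primeClasses φ ι)))
    (equalSumPairs (negPart (primeClasses φ ι)))

/-- `M = |min (supp (β(a)))|` (and `M = 0` if `β(a)` is the empty sequence). -/
noncomputable def minSupp {H P : Type*} [CommMonoid H]
    (φ : H →* Multiplicative (Multiset P)) (ι : ClassGp φ ≃* Multiplicative ℤ) (a : H) : ℕ :=
  (sInf {g : ℤ | g ∈ block φ ι a}).natAbs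

end KrullChain

/-! Since `φ` is a divisor homomorphism, `H_red` is identified with the monoid of sequences over `P`
whose classes sum to zero (`zeroWeight`), so everything takes place among multisets over `P` with
integer weights `w`.

Let `z = A₁ ⋯ Aₙ`, and let a factorization `y` of the same block satisfy `z⁺ ≤ y⁺`. Grouping the
atoms of `y` gives zero-sum sequences `B₁, …, Bₙ` with `Aⱼ⁺ = Bⱼ⁺`. Then `Aⱼ⁻` and `Bⱼ⁻` have equal
sums, so each pair `(Aⱼ⁻, Bⱼ⁻)` is a product of atoms of `ℰ`; the product of all these atoms is
symmetric, because `z` and `y` have the same negative terms in total. By definition of the relative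
Davenport constant `D`, at most `D` of the atoms already have a symmetric product. Exchanging just
these between the `Aⱼ` (`exists_exchange`) keeps the total product and all positive parts, and
changes at most `D` factors. Either all new factors are atoms, and the process goes on with fewer
atoms of `ℰ`, or some factor splits, and a longer factorization with finer positive parts appears
(`exists_chain_or_refinement`).

When a factor splits, each of its atoms must contain one of the newly received terms, as it would
otherwise be a proper part of the atom `Aⱼ`. An atom of `ℰ` hands over at most `M` terms
(`card_snd_le_of_mem_atoms`, by pigeonhole on partial sums), whence the bound `M * D`.

For the first claim, if `z⁺` is not maximal, a `y` with `y⁺ ≠ z⁺` is chosen; reaching its pattern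
with atoms would force `y⁺ = z⁺`, so the splitting case occurs (`exists_refinement`). Lengths are
bounded, so iteration ends in `Υ`. For the second claim, maximality excludes splitting, so the chain
reaches a factorization with the same blocks as `y`; what remains is to swap elements of `P` in the
same class, two atoms at a time (`exists_chain_of_map_eq`). The constant `D` is finite by Higman's
lemma (`exists_relDavenport_bound`). -/

namespace KrullChain

/-! ### Multisets -/

section Multisets

variable {α β J : Type*}

theorem exists_add_of_map_eq_add {f : α → β} {U : Multiset α} {V C : Multiset β}
    (h : U.map f = V + C) : ∃ U₁ U₂, U₁ + U₂ = U ∧ U₁.map f = V ∧ U₂.map f = C := by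
  induction V using Multiset.induction generalizing U with
  | empty => exact ⟨0, U, by simp, by simp, by simpa using h⟩
  | cons a V ih =>
    have ha : a ∈ U.map f := by rw [h]; simp
    obtain ⟨u, hu, rfl⟩ := Multiset.mem_map.mp ha
    obtain ⟨U', rfl⟩ := Multiset.exists_cons_of_mem hu
    rw [Multiset.map_cons, Multiset.cons_add, Multiset.cons_inj_right] at h
    obtain ⟨U₁, U₂, rfl, rfl, rfl⟩ := ih h
    exact ⟨u ::ₘ U₁, U₂, by simp, by simp, rfl⟩

theorem exists_le_of_le_map {f : α → β} {U : Multiset α} {V : Multiset β}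
    (h : V ≤ U.map f) : ∃ U₁ ≤ U, U₁.map f = V := by
  obtain ⟨C, hC⟩ := Multiset.le_iff_exists_add.mp h
  obtain ⟨U₁, U₂, rfl, h1, -⟩ := exists_add_of_map_eq_add hC
  exact ⟨U₁, Multiset.le_add_right _ _, h1⟩

/-- Peeling off one summand at a time lifts a partition of the image. It serves to distribute
elements of `P` when only their classes are prescribed, and to group the atoms of `y` along a
refinement. -/
theorem exists_sum_of_map_eq_sum {f : α → β} (s : Finset J) (ω : J → Multiset β)
    {U : Multiset α} (h : U.map f = ∑ j ∈ s, ω j) :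
    ∃ v : J → Multiset α, ∑ j ∈ s, v j = U ∧ ∀ j ∈ s, (v j).map f = ω j := by
  classical
  induction s using Finset.induction generalizing U with
  | empty => exact ⟨fun _ => 0, by simpa [eq_comm] using h, by simp⟩
  | insert a s ha ih =>
    rw [Finset.sum_insert ha] at h
    obtain ⟨U₁, U₂, rfl, h1, h2⟩ := exists_add_of_map_eq_add h
    obtain ⟨v, hv, hv'⟩ := ih h2
    refine ⟨Function.update v a U₁, ?_, ?_⟩
    · rw [Finset.sum_insert ha, Function.update_self, Finset.sum_update_of_notMem ha, hv]
    · intro j hj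
      rcases Finset.mem_insert.mp hj with rfl | hjs
      · simpa using h1
      · rw [Function.update_of_ne (by rintro rfl; exact ha hjs)]; exact hv' j hjs

theorem exists_sum_of_le_sum (s : Finset J) (ω : J → Multiset α) {W : Multiset α}
    (h : W ≤ ∑ j ∈ s, ω j) :
    ∃ v : J → Multiset α, ∑ j ∈ s, v j = W ∧ ∀ j ∈ s, v j ≤ ω j := by
  classical
  induction s using Finset.induction generalizing W with
  | empty => exact ⟨fun _ => 0, by simpa [eq_comm] using h, by simp⟩
  | insert a s ha ih =>
    rw [Finset.sum_insert ha] at h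
    obtain ⟨v, hv, hv'⟩ := ih (W := W - ω a) (by rw [add_comm] at h; simpa [Multiset.sub_le_iff_le_add] using h)
    refine ⟨Function.update v a (W ∩ ω a), ?_, ?_⟩
    · rw [Finset.sum_insert ha, Function.update_self, Finset.sum_update_of_notMem ha, hv,
        add_comm, Multiset.sub_add_inter]
    · intro j hj
      rcases Finset.mem_insert.mp hj with rfl | hjs
      · simpa using Multiset.inter_le_right
      · rw [Function.update_of_ne (by rintro rfl; exact ha hjs)]; exact hv' j hjs

theorem exists_fin_family (m : Multiset α) :
    ∃ (n : ℕ) (f : Fin n → α), Finset.univ.val.map f = m := by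
  induction m using Quotient.inductionOn with
  | h l => exact ⟨l.length, l.get, (Fin.univ_val_map l.get).trans (congrArg _ (List.ofFn_get l))⟩

theorem sum_singleton_eq_map (s : Finset J) (g : J → α) :
    ∑ j ∈ s, ({g j} : Multiset α) = s.val.map g := by
  have h := Multiset.map_map (fun x : α => ({x} : Multiset α)) g s.val
  rw [← Multiset.sum_map_singleton (s.val.map g), h]; rfl

theorem exists_family_of_map_eq [Fintype J] {f : α → β} {m : Multiset α} {g : J → β}
    (h : m.map f = Finset.univ.val.map g) :
    ∃ ω : J → α, Finset.univ.val.map ω = m ∧ ∀ j, f (ω j) = g j := by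
  rw [← sum_singleton_eq_map] at h
  obtain ⟨v, hv, hv'⟩ := exists_sum_of_map_eq_sum _ _ h
  have h1 : ∀ j, ∃ x, v j = {x} ∧ f x = g j := fun j => by
    obtain ⟨x, hx, hx'⟩ := Multiset.map_eq_singleton.mp (hv' j (Finset.mem_univ j))
    exact ⟨x, hx, hx'⟩
  choose ω hω hω' using h1
  refine ⟨ω, ?_, hω'⟩
  rw [← sum_singleton_eq_map, ← hv]
  exact Finset.sum_congr rfl fun j _ => (hω j).symm

theorem dist_add_le (a b c : Multiset α) :
    dist (a + c) (b + c) ≤ max (Multiset.card a) (Multiset.card b) := by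
  classical
  unfold dist
  refine max_le_max (Multiset.card_le_card ?_) (Multiset.card_le_card ?_)
  all_goals
    rw [Multiset.sub_le_iff_le_add, Multiset.le_iff_count]
    intro x
    simp only [Multiset.count_add]
    omega

theorem dist_map_le (f : α → β) (s t : Multiset α) : dist (s.map f) (t.map f) ≤ dist s t := by
  classical
  have h1 : s = (s - t) + s ∩ t := (Multiset.sub_add_inter s t).symm
  have h2 : t = (t - s) + s ∩ t := by rw [Multiset.inter_comm, Multiset.sub_add_inter]
  have h3 := dist_add_le ((s - t).map f) ((t - s).map f) ((s ∩ t).map f)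
  rw [← Multiset.map_add, ← Multiset.map_add, ← h1, ← h2] at h3
  simp only [Multiset.card_map] at h3
  convert h3 using 1
  unfold dist
  congr!

/-- If the sum of more than `|Q|` multisets is contained in `B + Q`, one of them is contained in
`B`. -/
theorem exists_le_of_card_lt {C : Multiset (Multiset α)} {B Q : Multiset α}
    (h : C.sum ≤ B + Q) (hQ : Multiset.card Q < Multiset.card C) : ∃ c ∈ C, c ≤ B := by
  classical
  induction Q using Multiset.induction generalizing C with
  | empty =>
    obtain ⟨c, hc⟩ := Multiset.card_pos_iff_exists_mem.mp hQ
    refine ⟨c, hc, (Multiset.single_le_sum (fun x _ => zero_le) c hc).trans ?_⟩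
    simpa using h
  | cons q Q ih =>
    -- A member containing `q` is discarded together with `q`: each term of `Q` spoils at most one
    -- member of `C`.
    by_cases hq : q ∈ C.sum
    · obtain ⟨c, hc, hqc⟩ := Multiset.mem_join.mp hq
      obtain ⟨C', rfl⟩ := Multiset.exists_cons_of_mem hc
      obtain ⟨c', rfl⟩ := Multiset.exists_cons_of_mem hqc
      have h1 : C'.sum ≤ B + Q := by
        rw [Multiset.sum_cons, Multiset.cons_add, Multiset.add_cons, Multiset.cons_le_cons_iff] at h
        exact (Multiset.le_add_left _ _).trans h
      obtain ⟨d, hd, hd'⟩ := ih h1 (by simpa using hQ)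
      exact ⟨d, Multiset.mem_cons_of_mem hd, hd'⟩
    · rw [Multiset.add_cons] at h
      refine ih ((Multiset.le_cons_of_notMem hq).mp h) ?_
      rw [Multiset.card_cons] at hQ
      omega

end Multisets

/-! ### Finiteness of relative Davenport constants -/

section Davenport

/-- Higman's lemma: words over a finite alphabet are partially well ordered under the subword
relation, and forgetting the order of the letters is monotone. -/
theorem isPWO_multiset {α : Type*} {s : Set α} (hs : s.Finite) :
    {S : Multiset α | ∀ g ∈ S, g ∈ s}.IsPWO := by
  have h1 : s.PartiallyWellOrderedOn (· = ·) := hs.partiallyWellOrderedOn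
  have h2 := Set.PartiallyWellOrderedOn.partiallyWellOrderedOn_sublistForall₂ (· = ·) h1
  have h3 := h2.image_of_monotone_on (r' := fun S T : Multiset α => S ≤ T)
    (f := fun l : List α => (l : Multiset α)) (by
      intro a _ b _ h
      obtain ⟨l, hl, hl'⟩ := List.sublistForall₂_iff.mp h
      rw [List.forall₂_eq_eq_eq] at hl
      subst hl
      exact hl'.subperm)
  refine h3.mono ?_
  intro S hS
  induction S using Quotient.inductionOn with
  | h l => exact ⟨l, fun x hx => hS x hx, rfl⟩

section Atoms

variable {D : Type*} [AddCancelCommMonoid D] [PartialOrder D] [CanonicallyOrderedAdd D]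

/-- A submonoid of a canonically ordered monoid is saturated if it is closed under differences. -/
def Saturated (M : AddSubmonoid D) : Prop :=
  ∀ x c, x ∈ M → x + c ∈ M → c ∈ M

/-- Saturation makes divisibility inside `M` the restriction of the order of `D`, and `0` is the
only unit; atoms are thus the minimal nonzero elements of `M`. -/
theorem mem_atoms_iff {M : AddSubmonoid D} (hM : Saturated M) {x : D} :
    x ∈ atoms M ↔ x ∈ M ∧ x ≠ 0 ∧ ∀ y ∈ M, y ≤ x → y = 0 ∨ y = x := by
  have hunit : ∀ y : M, IsAddUnit y ↔ (y : D) = 0 := by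
    intro y
    constructor
    · rintro ⟨u, rfl⟩
      have h : ((u : M) : D) + ((↑(-u) : M) : D) = 0 := by
        rw [← AddSubmonoid.coe_add, AddUnits.add_neg]; rfl
      exact (add_eq_zero.mp h).1
    · intro h
      rw [show y = 0 from Subtype.ext h]
      exact isAddUnit_zero
  constructor
  · rintro ⟨hx, h⟩
    refine ⟨hx, fun h0 => h.not_isAddUnit ((hunit _).2 h0), fun y hy hyx => ?_⟩
    obtain ⟨c, rfl⟩ := le_iff_exists_add.mp hyx
    have hc := hM y c hy hx
    rcases h.isAddUnit_or_isAddUnit (a := ⟨y, hy⟩) (b := ⟨c, hc⟩) rfl with h1 | h1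
    · exact Or.inl ((hunit _).1 h1)
    · right
      have : c = 0 := (hunit _).1 h1
      simp [this]
  · rintro ⟨hx, h0, h⟩
    refine ⟨hx, fun hu => h0 ((hunit _).1 hu), ?_⟩
    rintro ⟨b, hb⟩ ⟨c, hc⟩ hbc
    have hbc' : x = b + c := congrArg Subtype.val hbc
    rcases h b hb (le_iff_exists_add.mpr ⟨c, hbc'⟩) with h1 | h1
    · exact Or.inl ((hunit _).2 h1)
    · right
      rw [hunit]
      have h2 : b + 0 = b + c := by rw [add_zero, ← hbc', h1]
      exact (add_left_cancel h2).symm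

theorem exists_factorization [WellFoundedLT D] {M : AddSubmonoid D} (hM : Saturated M) {x : D}
    (hx : x ∈ M) : ∃ z : Multiset D, (∀ u ∈ z, u ∈ atoms M) ∧ z.sum = x := by
  induction x using WellFoundedLT.induction with
  | ind x ih =>
    by_cases h0 : x = 0
    · exact ⟨0, by simp, by simp [h0]⟩
    by_cases ha : x ∈ atoms M
    · exact ⟨{x}, by simpa using ha, by simp⟩
    rw [mem_atoms_iff hM] at ha
    push Not at ha
    obtain ⟨y, hy, hyx, hy0, hne⟩ := ha hx h0
    obtain ⟨c, rfl⟩ := le_iff_exists_add.mp hyx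
    have hc := hM y c hy hx
    have hc' : c < y + c := by
      refine lt_of_le_of_ne (le_iff_exists_add.mpr ⟨y, add_comm _ _⟩) fun h => hy0 ?_
      have h2 : 0 + c = y + c := by rw [zero_add, ← h]
      exact (add_right_cancel h2).symm
    obtain ⟨z1, h1, h1'⟩ := ih y (lt_of_le_of_ne hyx hne) hy
    obtain ⟨z2, h2, h2'⟩ := ih c hc' hc
    refine ⟨z1 + z2, ?_, by simp [h1', h2']⟩
    intro u hu
    rcases Multiset.mem_add.mp hu with hu | hu
    · exact h1 u hu
    · exact h2 u hu

/-- Atoms form an antichain in a partially well ordered set, so they are finite in number. Formal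
products of them are then partially well ordered too; those with value in `S` have finitely many
minimal nontrivial ones, and the greatest length among these is a bound. -/
theorem exists_relDavenport_bound [WellFoundedLT D] {S M : AddSubmonoid D} (hM : Saturated M)
    (hpwo : (M : Set D).IsPWO) :
    ∃ N : ℕ, relDavenport S M = N ∧
      ∀ z : Multiset D, z ≠ 0 → (∀ u ∈ z, u ∈ atoms M) → z.sum ∈ S →
        ∃ z' ≤ z, z' ≠ 0 ∧ z'.sum ∈ S ∧ Multiset.card z' ≤ N := by
  have hfin : (atoms M).Finite := by
    refine IsAntichain.finite_of_partiallyWellOrderedOn (r := (· ≤ ·)) ?_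
      (hpwo.mono fun x hx => ((mem_atoms_iff hM).mp hx).1)
    intro x hx y hy hne hle
    obtain ⟨hx1, hx0, -⟩ := (mem_atoms_iff hM).mp hx
    rcases ((mem_atoms_iff hM).mp hy).2.2 x hx1 hle with h | h
    · exact hx0 h
    · exact hne h
  let Z : Set (Multiset D) := {z | z ≠ 0 ∧ (∀ u ∈ z, u ∈ atoms M) ∧ z.sum ∈ S}
  have hZ : Z.IsPWO := (isPWO_multiset hfin).mono fun z hz => hz.2.1
  have hmin : {z | Minimal (· ∈ Z) z}.Finite :=
    (setOfPred_minimal_antichain _).finite_of_partiallyWellOrderedOn (hZ.mono fun z hz => hz.prop)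
  obtain ⟨K, hK⟩ := (hmin.image Multiset.card).bddAbove
  -- The maximum with `1` meets the requirement `1 ≤ N`, since `K` may be `0`.
  have hne : ((max K 1 : ℕ) : ℕ∞) ∈ {N : ℕ∞ | 1 ≤ N ∧ ∀ z : Multiset D, z ≠ 0 →
      (∀ u ∈ z, u ∈ atoms M) → z.sum ∈ S →
      ∃ z' ≤ z, z' ≠ 0 ∧ z'.sum ∈ S ∧ (Multiset.card z' : ℕ∞) ≤ N} := by
    refine ⟨by exact_mod_cast le_max_right K 1, fun z hz hza hzS => ?_⟩
    obtain ⟨z', hz', hz'm⟩ := hZ.exists_le_minimal (a := z) ⟨hz, hza, hzS⟩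
    refine ⟨z', hz', hz'm.prop.1, hz'm.prop.2.2, ?_⟩
    exact_mod_cast (hK ⟨z', hz'm, rfl⟩).trans (le_max_left K 1)
  -- The infimum is attained, so the constant itself has the defining property.
  have hmem := csInf_mem ⟨_, hne⟩
  have hlt : relDavenport S M ≤ ((max K 1 : ℕ) : ℕ∞) := sInf_le hne
  obtain ⟨N, hN⟩ := ENat.ne_top_iff_exists.mp (ne_top_of_le_ne_top (ENat.natCast_ne_top _) hlt)
  refine ⟨N, hN.symm, fun z hz hza hzS => ?_⟩
  obtain ⟨z', h1, h2, h3, h4⟩ := hmem.2 z hz hza hzS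
  refine ⟨z', h1, h2, h3, ?_⟩
  change _ ≤ relDavenport S M at h4
  rw [← hN] at h4
  exact_mod_cast h4

end Atoms

end Davenport

/-! ### Equal sum pairs of negative sequences -/

section EqualSumPairs

variable {L : Set ℤ}

theorem saturated_equalSumPairs (L : Set ℤ) : Saturated (equalSumPairs L) := by
  rintro ⟨x1, x2⟩ ⟨c1, c2⟩ ⟨h1, h2, h3⟩ ⟨h4, h5, h6⟩
  refine ⟨fun g hg => h4 g (Multiset.mem_add.mpr (Or.inr hg)),
    fun g hg => h5 g (Multiset.mem_add.mpr (Or.inr hg)), ?_⟩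
  simp only [Prod.fst_add, Prod.snd_add, Multiset.sum_add] at h3 h6 ⊢
  linarith

theorem isPWO_equalSumPairs (hL : L.Finite) :
    ((equalSumPairs L : AddSubmonoid _) : Set (Multiset ℤ × Multiset ℤ)).IsPWO :=
  ((isPWO_multiset hL).prod (isPWO_multiset hL)).mono fun _ hx => ⟨hx.1, hx.2.1⟩

theorem sum_neg_of_ne_zero {S : Multiset ℤ} (h : ∀ g ∈ S, g < 0) (h0 : S ≠ 0) : S.sum < 0 := by
  induction S using Multiset.induction with
  | empty => exact absurd rfl h0
  | cons a S ih =>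
    rw [Multiset.sum_cons]
    have ha := h a (Multiset.mem_cons_self a S)
    by_cases hS : S = 0
    · simpa [hS] using ha
    · have := ih (fun g hg => h g (Multiset.mem_cons_of_mem hg)) hS
      linarith

theorem fst_ne_zero_of_mem_atoms (hL : ∀ g ∈ L, g < 0) {e : Multiset ℤ × Multiset ℤ}
    (he : e ∈ atoms (equalSumPairs L)) : e.1 ≠ 0 := by
  obtain ⟨⟨h1, h2, h3⟩, h0, -⟩ := (mem_atoms_iff (saturated_equalSumPairs L)).mp he
  intro h
  rw [h, Multiset.sum_zero] at h3
  by_cases h' : e.2 = 0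
  · exact h0 (Prod.ext h h')
  · exact (sum_neg_of_ne_zero (fun g hg => hL g (h2 g hg)) h').ne h3.symm

theorem snd_ne_zero_of_mem_atoms (hL : ∀ g ∈ L, g < 0) {e : Multiset ℤ × Multiset ℤ}
    (he : e ∈ atoms (equalSumPairs L)) : e.2 ≠ 0 := by
  obtain ⟨⟨h1, h2, h3⟩, h0, -⟩ := (mem_atoms_iff (saturated_equalSumPairs L)).mp he
  intro h
  rw [h, Multiset.sum_zero] at h3
  exact (sum_neg_of_ne_zero (fun g hg => hL g (h1 g hg))
    (fst_ne_zero_of_mem_atoms hL he)).ne h3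

theorem coe_take_drop_le {l : List ℤ} {i j : ℕ} :
    (((l.take j).drop i : List ℤ) : Multiset ℤ) ≤ (l : Multiset ℤ) :=
  ((List.drop_sublist _ _).trans (List.take_sublist _ _)).subperm

theorem sum_take_drop {l : List ℤ} {i j : ℕ} (h : i ≤ j) :
    ((l.take j).drop i).sum = (l.take j).sum - (l.take i).sum := by
  have h1 := List.take_append_drop i (l.take j)
  rw [List.take_take, min_eq_left h] at h1
  rw [← h1, List.sum_append, h1]
  ring

theorem sum_nonpos_of_neg {S : Multiset ℤ} (h : ∀ g ∈ S, g < 0) : S.sum ≤ 0 := by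
  by_cases h0 : S = 0
  · simp [h0]
  · exact (sum_neg_of_ne_zero h h0).le

/-- In an atom `(S₁, S₂)` of the monoid of equal sum pairs of negative sequences, the length of
`S₂` is bounded by the largest absolute value of a term of `S₁`. -/
theorem card_snd_le_of_mem_atoms (hL : ∀ g ∈ L, g < 0) {e : Multiset ℤ × Multiset ℤ}
    (he : e ∈ atoms (equalSumPairs L)) {M : ℕ} (hM : ∀ g ∈ e.1, -(M : ℤ) ≤ g) :
    Multiset.card e.2 ≤ M := by
  classical
  have hne1 := fst_ne_zero_of_mem_atoms hL he
  obtain ⟨⟨h1, h2, h3⟩, h0, hmin⟩ := (mem_atoms_iff (saturated_equalSumPairs L)).mp he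
  obtain ⟨e1, e2⟩ := e
  induction e1 using Quotient.inductionOn with | h l => ?_
  induction e2 using Quotient.inductionOn with | h b => ?_
  change ∀ g ∈ l, g ∈ L at h1
  change ∀ g ∈ b, g ∈ L at h2
  change ∀ g ∈ l, -(M : ℤ) ≤ g at hM
  replace h3 : l.sum = b.sum := h3
  change b.length ≤ M
  by_contra! hlt
  have hM1 : 1 ≤ M := by
    obtain ⟨g, hg⟩ := Multiset.exists_mem_of_ne_zero hne1
    have := hM g hg
    have := hL g (h1 g hg)
    omega
  have hlneg : ∀ {i j : ℕ}, ∀ g ∈ (((l.take j).drop i : List ℤ) : Multiset ℤ), g < 0 :=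
    fun g hg => hL g (h1 g (List.mem_of_mem_take (List.mem_of_mem_drop hg)))
  have hbneg : ∀ {i j : ℕ}, ∀ g ∈ (((b.take j).drop i : List ℤ) : Multiset ℤ), g < 0 :=
    fun g hg => hL g (h2 g (List.mem_of_mem_take (List.mem_of_mem_drop hg)))
  have hbmono : ∀ {i j : ℕ}, i ≤ j → (b.take j).sum ≤ (b.take i).sum := fun {i j} hij => by
    have h4 := sum_nonpos_of_neg (hbneg (i := i) (j := j))
    rw [Multiset.sum_coe, sum_take_drop hij] at h4
    linarith
  have hex : ∀ k, ∃ i, (l.take i).sum ≤ (b.take k).sum := fun k => by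
    refine ⟨l.length, ?_⟩
    rw [List.take_length, h3]
    by_cases hk : k ≤ b.length
    · simpa using hbmono hk
    · rw [List.take_of_length_le (by omega)]
  -- `f k` is the first position at which the partial sums of `l` have fallen to the `k`-th partial
  -- sum of `b`. The overshoot lies in `[0, M)`, because a single term of `l` lowers the sum by at
  -- most `M`.
  let f : ℕ → ℕ := fun k => Nat.find (hex k)
  have hf : ∀ k, (l.take (f k)).sum ≤ (b.take k).sum := fun k => Nat.find_spec (hex k)
  have hf' : ∀ k, (b.take k).sum - (l.take (f k)).sum < M := fun k => by
    rcases hi : f k with _ | i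
    · have h4 := sum_nonpos_of_neg (hbneg (i := 0) (j := k))
      simp only [List.drop_zero, Multiset.sum_coe] at h4
      simp only [List.take_zero, List.sum_nil]
      omega
    · have h4 : ¬ (l.take i).sum ≤ (b.take k).sum :=
        Nat.find_min (hex k) (by change i < f k; omega)
      by_cases hil : i < l.length
      · rw [List.sum_take_succ _ _ hil]
        have := hM l[i] (List.getElem_mem hil)
        omega
      · have h5 := hf k
        rw [hi, List.take_of_length_le (show l.length ≤ i + 1 by omega)] at h5
        rw [List.take_of_length_le (show l.length ≤ i by omega)] at h4
        exact absurd h5 h4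
  have hfmono : ∀ {k k' : ℕ}, k ≤ k' → f k ≤ f k' := fun {k k'} hkk =>
    Nat.find_min' (hex k) ((hf k').trans (hbmono hkk))
  -- For `k = 0, …, M` there are `M + 1` overshoots with only `M` possible values. Where two agree,
  -- the segments in between have equal sums.
  obtain ⟨k, hk, k', hk', hne, heq⟩ := Finset.exists_ne_map_eq_of_card_lt_of_maps_to
    (s := Finset.range (M + 1)) (t := Finset.range M)
    (f := fun k => ((b.take k).sum - (l.take (f k)).sum).toNat) (by simp) (by
      intro k _
      have := hf k
      have := hf' k
      simp only [Finset.coe_range, Set.mem_Iio]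
      omega)
  wlog hkk : k < k' generalizing k k'
  · exact this k' hk' k hk hne.symm heq.symm (by omega)
  have heq' : (b.take k).sum - (l.take (f k)).sum = (b.take k').sum - (l.take (f k')).sum := by
    have := hf k
    have := hf k'
    omega
  rw [Finset.mem_range] at hk hk'
  have hlen : ((b.take k').drop k).length = k' - k := by
    rw [List.length_drop, List.length_take]
    omega
  have hX : ((((l.take (f k')).drop (f k) : List ℤ) : Multiset ℤ),
      (((b.take k').drop k : List ℤ) : Multiset ℤ)) ∈ equalSumPairs L := by
    refine ⟨fun g hg => h1 g (List.mem_of_mem_take (List.mem_of_mem_drop hg)),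
      fun g hg => h2 g (List.mem_of_mem_take (List.mem_of_mem_drop hg)), ?_⟩
    simp only [Multiset.sum_coe]
    rw [sum_take_drop (hfmono hkk.le), sum_take_drop hkk.le]
    linarith
  -- The segment of `b` has at least `1` and at most `M < b.length` terms, so the pair is neither
  -- trivial nor the whole atom.
  rcases hmin _ hX ⟨coe_take_drop_le, coe_take_drop_le⟩ with h | h
  · have h5 := congrArg (fun x => Multiset.card x.2) h
    simp only [Multiset.coe_card, hlen, Prod.snd_zero, Multiset.card_zero] at h5
    omega
  · have h5 := congrArg (fun x => Multiset.card x.2) h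
    simp only [Multiset.coe_card, hlen] at h5
    change k' - k = b.length at h5
    omega

end EqualSumPairs

/-! ### Atoms of block monoids -/

section Blocks

/-- The subsequence of negative terms. -/
def negSeq (S : Multiset ℤ) : Multiset ℤ :=
  S.filter fun g => g < 0

theorem posSeq_add (S T : Multiset ℤ) : posSeq (S + T) = posSeq S + posSeq T :=
  Multiset.filter_add _ _ _

theorem negSeq_add (S T : Multiset ℤ) : negSeq (S + T) = negSeq S + negSeq T :=
  Multiset.filter_add _ _ _

theorem posSeq_sum (z : Multiset (Multiset ℤ)) : posSeq z.sum = (z.map posSeq).sum := by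
  induction z using Multiset.induction with
  | empty => rfl
  | cons a z ih => rw [Multiset.sum_cons, posSeq_add, ih, Multiset.map_cons, Multiset.sum_cons]

theorem negSeq_finset_sum {J : Type*} (s : Finset J) (f : J → Multiset ℤ) :
    negSeq (∑ j ∈ s, f j) = ∑ j ∈ s, negSeq (f j) :=
  map_sum (⟨⟨negSeq, rfl⟩, negSeq_add⟩ : Multiset ℤ →+ Multiset ℤ) f s

theorem negSeq_le (S : Multiset ℤ) : negSeq S ≤ S := Multiset.filter_le _ _

theorem posSeq_add_negSeq_add (S : Multiset ℤ) :
    posSeq S + negSeq S + S.filter (· = 0) = S := by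
  induction S using Multiset.induction with
  | empty => rfl
  | cons a S ih =>
    unfold posSeq negSeq at *
    conv_rhs => rw [← ih]
    rcases lt_trichotomy a 0 with h | h | h
    · simp [h, h.not_gt, h.ne]
    · simp [h]
    · simp [h, h.not_gt, h.ne']

theorem sum_filter_eq_zero (S : Multiset ℤ) : (S.filter (· = 0)).sum = 0 :=
  Multiset.sum_eq_zero fun _ hx => (Multiset.mem_filter.mp hx).2

theorem posSeq_sum_add_negSeq_sum (S : Multiset ℤ) :
    (posSeq S).sum + (negSeq S).sum = S.sum := by
  conv_rhs => rw [← posSeq_add_negSeq_add S]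
  rw [Multiset.sum_add, Multiset.sum_add, sum_filter_eq_zero, add_zero]

theorem negSeq_eq_zero_of_posSeq_eq_zero {S : Multiset ℤ} (hS : S.sum = 0)
    (h : posSeq S = 0) : negSeq S = 0 := by
  by_contra h0
  have h1 := posSeq_sum_add_negSeq_sum S
  rw [h, hS, Multiset.sum_zero, zero_add] at h1
  exact (sum_neg_of_ne_zero (fun g hg => (Multiset.mem_filter.mp hg).2) h0).ne h1

variable {G : Set ℤ}

theorem saturated_zeroSumSeqs (G : Set ℤ) : Saturated (zeroSumSeqs G) := by
  rintro x c ⟨h1, h2⟩ ⟨h3, h4⟩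
  refine ⟨fun g hg => h3 g (Multiset.mem_add.mpr (Or.inr hg)), ?_⟩
  rw [Multiset.sum_add] at h4
  linarith

/-- A term `0` is by itself a zero-sum sequence, so an atom containing it is `{0}`. Any other atom
needs positive terms to balance its negative ones. -/
theorem eq_or_eq_singleton_zero {B : Multiset ℤ} (hB : B ∈ atoms (zeroSumSeqs G)) :
    posSeq B + negSeq B = B ∧ posSeq B ≠ 0 ∨ B = {0} := by
  obtain ⟨⟨h1, h2⟩, h0, hmin⟩ := (mem_atoms_iff (saturated_zeroSumSeqs G)).mp hB
  have hd := posSeq_add_negSeq_add B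
  by_cases hz : (0 : ℤ) ∈ B
  · right
    have h5 : ({0} : Multiset ℤ) ∈ zeroSumSeqs G :=
      ⟨fun g hg => by rw [Multiset.mem_singleton.mp hg]; exact h1 0 hz, by simp⟩
    rcases hmin _ h5 (Multiset.singleton_le.mpr hz) with h | h
    · exact absurd h (Multiset.singleton_ne_zero _)
    · exact h.symm
  · left
    have hz' : B.filter (· = 0) = 0 := Multiset.filter_eq_nil.mpr fun a ha h => hz (h ▸ ha)
    rw [hz', add_zero] at hd
    refine ⟨hd, fun hp => h0 ?_⟩
    rw [← hd, hp, negSeq_eq_zero_of_posSeq_eq_zero h2 hp, add_zero]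

theorem posSeq_eq_zero_iff {B : Multiset ℤ} (hB : B ∈ atoms (zeroSumSeqs G)) :
    posSeq B = 0 ↔ B = {0} := by
  constructor
  · intro h
    exact (eq_or_eq_singleton_zero hB).resolve_left fun h' => h'.2 h
  · rintro rfl; rfl

theorem eq_of_posSeq_eq_of_negSeq_eq {B C : Multiset ℤ} (hB : B ∈ atoms (zeroSumSeqs G))
    (hC : C ∈ atoms (zeroSumSeqs G)) (hp : posSeq B = posSeq C) (hn : negSeq B = negSeq C) :
    B = C := by
  rcases eq_or_eq_singleton_zero hB with h | h
  · rcases eq_or_eq_singleton_zero hC with h' | h'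
    · rw [← h.1, ← h'.1, hp, hn]
    · rw [← posSeq_eq_zero_iff hC, ← hp] at h'
      exact absurd h' h.2
  · rw [h, eq_comm, ← posSeq_eq_zero_iff hC, ← hp, h]
    rfl

theorem count_zero_of_mem_atoms {B : Multiset ℤ} (hB : B ∈ atoms (zeroSumSeqs G)) :
    B.count 0 = if posSeq B = 0 then 1 else 0 := by
  rcases eq_or_eq_singleton_zero hB with h | h
  · rw [if_neg h.2, Multiset.count_eq_zero]
    intro h0
    rw [← h.1, Multiset.mem_add] at h0
    rcases h0 with h0 | h0 <;> exact absurd (Multiset.mem_filter.mp h0).2 (lt_irrefl _)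
  · rw [if_pos ((posSeq_eq_zero_iff hB).mpr h), h, Multiset.count_singleton_self]

/-- The number of empty sequences in `z⁺` is determined by the product of `z`. -/
theorem count_zero_posFact {z : Multiset (Multiset ℤ)}
    (hz : ∀ U ∈ z, U ∈ atoms (zeroSumSeqs G)) : (posFact z).count 0 = z.sum.count 0 := by
  induction z using Multiset.induction with
  | empty => rfl
  | cons B z ih =>
    have hB := count_zero_of_mem_atoms (hz B (Multiset.mem_cons_self B z))
    rw [posFact, Multiset.map_cons, Multiset.count_cons, Multiset.sum_cons, Multiset.count_add,
      hB, add_comm, ← ih fun U hU => hz U (Multiset.mem_cons_of_mem hU)]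
    simp only [posFact, eq_comm]

/-! ### Zero-sum sequences over a weighted set `P`. -/

variable {P : Type*} (w : P → ℤ)

/-- The monoid of sequences over `P` whose weights sum up to zero. -/
def zeroWeight : AddSubmonoid (Multiset P) where
  carrier := {X | (X.map w).sum = 0}
  zero_mem' := by simp
  add_mem' := by
    intro S T hS hT
    simp only [Set.mem_ofPred_eq] at *
    simp [hS, hT]

theorem mem_zeroWeight {X : Multiset P} : X ∈ zeroWeight w ↔ (X.map w).sum = 0 := Iff.rfl

theorem saturated_zeroWeight : Saturated (zeroWeight w) := by
  intro x c h1 h2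
  rw [mem_zeroWeight] at *
  rw [Multiset.map_add, Multiset.sum_add] at h2
  linarith

variable {w}

theorem map_mem_zeroSumSeqs {X : Multiset P} :
    X.map w ∈ zeroSumSeqs (Set.range w) ↔ X ∈ zeroWeight w := by
  constructor
  · exact fun h => h.2
  · refine fun h => ⟨fun g hg => ?_, h⟩
    obtain ⟨p, -, rfl⟩ := Multiset.mem_map.mp hg
    exact ⟨p, rfl⟩

/-- Every subsequence of `X.map w` lifts to a subsequence of `X`, so being an atom depends on the
weights only. -/
theorem map_mem_atoms_iff {X : Multiset P} :
    X.map w ∈ atoms (zeroSumSeqs (Set.range w)) ↔ X ∈ atoms (zeroWeight w) := by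
  rw [mem_atoms_iff (saturated_zeroSumSeqs _), mem_atoms_iff (saturated_zeroWeight w),
    map_mem_zeroSumSeqs]
  refine and_congr_right fun hX => and_congr (by simp) ⟨fun h Y hY hle => ?_, fun h V hV hle => ?_⟩
  · rcases h _ (map_mem_zeroSumSeqs.mpr hY) (Multiset.map_le_map hle) with h | h
    · exact Or.inl (Multiset.map_eq_zero.mp h)
    · refine Or.inr (Multiset.eq_of_le_of_card_le hle ?_)
      have := congrArg Multiset.card h
      simp only [Multiset.card_map] at this
      exact this.ge
  · obtain ⟨Y, hY, rfl⟩ := exists_le_of_le_map hle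
    rcases h Y (map_mem_zeroSumSeqs.mp hV) hY with rfl | rfl
    · simp
    · simp

end Blocks

/-! ### Exchange steps between factorizations -/

section Steps

variable {P J : Type*} {w : P → ℤ}

theorem dist_sum_le [Fintype J] {α : Type*} (K : Finset J) (A : J → α) (f : J → Multiset α)
    (h : ∀ j ∉ K, f j = {A j}) :
    dist (Finset.univ.val.map A) (∑ j, f j) ≤ max K.card (∑ j ∈ K, Multiset.card (f j)) := by
  classical
  rw [← sum_singleton_eq_map, ← Finset.sum_add_sum_compl K (fun j => ({A j} : Multiset α)),
    ← Finset.sum_add_sum_compl K f,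
    Finset.sum_congr rfl fun j hj => h j (Finset.mem_compl.mp hj)]
  refine (dist_add_le _ _ _).trans ?_
  simp [Multiset.card_sum]

theorem eq_singleton_of_sum_mem_atoms {f : Multiset (Multiset P)}
    (hf : ∀ U ∈ f, U ∈ atoms (zeroWeight w)) (h : f.sum ∈ atoms (zeroWeight w)) :
    f = {f.sum} := by
  have hs := (mem_atoms_iff (saturated_zeroWeight w)).mp h
  induction f using Multiset.induction with
  | empty => exact absurd rfl hs.2.1
  | cons U f _ =>
    have hU := (mem_atoms_iff (saturated_zeroWeight w)).mp (hf U (Multiset.mem_cons_self U f))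
    rw [Multiset.sum_cons] at hs ⊢
    rcases hs.2.2 U hU.1 (Multiset.le_add_right _ _) with h0 | h0
    · exact absurd h0 hU.2.1
    · have h1 : f.sum = 0 := by simpa using h0
      rcases Multiset.empty_or_exists_mem f with rfl | ⟨V, hV⟩
      · simp
      · have hV0 := ((mem_atoms_iff (saturated_zeroWeight w)).mp
          (hf V (Multiset.mem_cons_of_mem hV))).2.1
        exact absurd (Multiset.sum_eq_zero_iff.mp h1 V hV) hV0

variable (w)

/-- The positive parts of the weights of the factors of `z`. -/
def posOf (z : Multiset (Multiset P)) : Multiset (Multiset ℤ) :=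
  z.map fun U => posSeq (U.map w)

theorem posOf_eq (z : Multiset (Multiset P)) : posOf w z = posFact (z.map (Multiset.map w)) := by
  rw [posFact, Multiset.map_map]
  rfl

theorem posOf_finset_sum (s : Finset J) (f : J → Multiset (Multiset P)) :
    posOf w (∑ j ∈ s, f j) = ∑ j ∈ s, posOf w (f j) :=
  map_sum (Multiset.mapAddMonoidHom fun U : Multiset P => posSeq (U.map w)) f s

theorem sum_posOf (z : Multiset (Multiset P)) : (posOf w z).sum = posSeq (z.sum.map w) := by
  induction z using Multiset.induction with
  | empty => rfl
  | cons U z ih =>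
    rw [Multiset.sum_cons, Multiset.map_add, posSeq_add, ← ih, posOf, Multiset.map_cons,
      Multiset.sum_cons, posOf]

/-- One step of a chain of factorizations with constant positive parts. -/
def Step (d : ℕ) (z z' : Multiset (Multiset P)) : Prop :=
  (∀ U ∈ z', U ∈ atoms (zeroWeight w)) ∧ z'.sum = z.sum ∧ posOf w z' = posOf w z ∧ dist z z' ≤ d

variable {w}

theorem Step.mono {d d' : ℕ} (h : d ≤ d') {z z' : Multiset (Multiset P)} (hz : Step w d z z') :
    Step w d' z z' :=
  ⟨hz.1, hz.2.1, hz.2.2.1, hz.2.2.2.trans h⟩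

theorem chain_invariants {d : ℕ} {z z' : Multiset (Multiset P)}
    (h : Relation.ReflTransGen (Step w d) z z') (hz : ∀ U ∈ z, U ∈ atoms (zeroWeight w)) :
    (∀ U ∈ z', U ∈ atoms (zeroWeight w)) ∧ z'.sum = z.sum ∧ posOf w z' = posOf w z := by
  induction h with
  | refl => exact ⟨hz, rfl, rfl⟩
  | tail _ h ih => exact ⟨h.1, h.2.1.trans ih.2.1, h.2.2.1.trans ih.2.2⟩

theorem posSeq_of_neg {S : Multiset ℤ} (h : ∀ g ∈ S, g < 0) : posSeq S = 0 :=
  Multiset.filter_eq_nil.mpr fun a ha => (h a ha).not_gt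

theorem negSeq_of_neg {S : Multiset ℤ} (h : ∀ g ∈ S, g < 0) : negSeq S = S :=
  Multiset.filter_eq_self.mpr h

theorem map_finset_sum (s : Finset J) (f : J → Multiset P) :
    (∑ j ∈ s, f j).map w = ∑ j ∈ s, (f j).map w :=
  map_sum (Multiset.mapAddMonoidHom w) f s

theorem finset_sum_multiset_sum {D : Type*} [AddCommMonoid D] (s : Finset J)
    (f : J → Multiset D) : (∑ j ∈ s, f j).sum = ∑ j ∈ s, (f j).sum :=
  map_sum (Multiset.sumAddMonoidHom : Multiset D →+ D) f s

theorem card_snd_sum_le {V : Multiset (Multiset ℤ × Multiset ℤ)} {m : ℕ}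
    (h : ∀ e ∈ V, Multiset.card e.2 ≤ m) : Multiset.card V.sum.2 ≤ m * Multiset.card V := by
  induction V using Multiset.induction with
  | empty => simp
  | cons e V ih =>
    have h1 := h e (Multiset.mem_cons_self e V)
    have h2 := ih fun e' he' => h e' (Multiset.mem_cons_of_mem he')
    rw [Multiset.sum_cons, Prod.snd_add, Multiset.card_add, Multiset.card_cons, mul_add, mul_one]
    omega

theorem fst_mono {V W : Multiset (Multiset ℤ × Multiset ℤ)} (h : V ≤ W) : V.sum.1 ≤ W.sum.1 := by
  obtain ⟨U, rfl⟩ := Multiset.le_iff_exists_add.mp h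
  rw [Multiset.sum_add, Prod.fst_add]
  exact Multiset.le_add_right _ _

theorem snd_mono {V W : Multiset (Multiset ℤ × Multiset ℤ)} (h : V ≤ W) : V.sum.2 ≤ W.sum.2 := by
  obtain ⟨U, rfl⟩ := Multiset.le_iff_exists_add.mp h
  rw [Multiset.sum_add, Prod.snd_add]
  exact Multiset.le_add_right _ _

theorem fst_le_sum {V : Multiset (Multiset ℤ × Multiset ℤ)} {e : Multiset ℤ × Multiset ℤ}
    (he : e ∈ V) : e.1 ≤ V.sum.1 := by
  simpa using fst_mono (Multiset.singleton_le.mpr he)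

theorem snd_le_sum {V : Multiset (Multiset ℤ × Multiset ℤ)} {e : Multiset ℤ × Multiset ℤ}
    (he : e ∈ V) : e.2 ≤ V.sum.2 := by
  simpa using snd_mono (Multiset.singleton_le.mpr he)

theorem sum_mem_of_atoms {D : Type*} [AddCommMonoid D] {M : AddSubmonoid D} {V : Multiset D}
    (h : ∀ e ∈ V, e ∈ atoms M) : V.sum ∈ M :=
  AddSubmonoid.multiset_sum_mem _ _ fun e he => (h e he).1

variable {L : Set ℤ} [Fintype J]

/-- Exchanging negative terms between the atoms `A j` along a symmetric product `W'` of atoms of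
the monoid of equal sum pairs. -/
theorem exists_exchange (hL : ∀ g ∈ L, g < 0) {A : J → Multiset P}
    (hA : ∀ j, A j ∈ atoms (zeroWeight w)) {W : J → Multiset (Multiset ℤ × Multiset ℤ)}
    (hW : ∀ j, ∀ e ∈ W j, e ∈ atoms (equalSumPairs L))
    (hle : ∀ j, (W j).sum.1 ≤ negSeq ((A j).map w)) {m : ℕ}
    (hm : ∀ j, ∀ e ∈ W j, Multiset.card e.2 ≤ m) {W' : Multiset (Multiset ℤ × Multiset ℤ)}
    (hW' : W' ≤ ∑ j, W j) (hS : W'.sum ∈ symmPairs L) :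
    ∃ V : J → Multiset (Multiset ℤ × Multiset ℤ), (∀ j, V j ≤ W j) ∧ ∑ j, V j = W' ∧
      ∃ A' : J → Multiset P, (∀ j, A' j ∈ zeroWeight w) ∧ (∀ j, A' j ≠ 0) ∧
        ∑ j, A' j = ∑ j, A j ∧
        (∀ j, posSeq ((A' j).map w) = posSeq ((A j).map w)) ∧
        (∀ j, negSeq ((A' j).map w) + (V j).sum.1 = negSeq ((A j).map w) + (V j).sum.2) ∧
        (∀ j, V j = 0 → A' j = A j) ∧
        ∀ j f, (∀ U ∈ f, U ∈ atoms (zeroWeight w)) → f.sum = A' j → V j ≠ 0 →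
          Multiset.card f ≤ m * Multiset.card (V j) := by
  obtain ⟨V, hVsum, hV⟩ := exists_sum_of_le_sum _ _ hW'
  replace hV := fun j => hV j (Finset.mem_univ j)
  have hVE : ∀ j, (V j).sum ∈ equalSumPairs L := fun j =>
    sum_mem_of_atoms fun e he => hW j e (Multiset.mem_of_le (hV j) he)
  -- `R j` is what `A j` gives away, chosen in `P` with the classes prescribed by `V j`; `B j` is
  -- what it keeps.
  have hR : ∀ j, ∃ R B, R + B = A j ∧ R.map w = (V j).sum.1 := fun j => by
    obtain ⟨R, hR, hRw⟩ :=
      exists_le_of_le_map (((fst_mono (hV j)).trans (hle j)).trans (negSeq_le _))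
    obtain ⟨B, hB⟩ := Multiset.le_iff_exists_add.mp hR
    exact ⟨R, B, hB.symm, hRw⟩
  choose R B hRB hRw using hR
  -- By symmetry of `W'`, the elements given away have in total exactly the classes that are to be
  -- received. They can therefore be redistributed as `Q j`, which leaves the product in `P`
  -- unchanged.
  have hQ : (∑ j, R j).map w = ∑ j, (V j).sum.2 := by
    rw [map_finset_sum, Finset.sum_congr rfl fun j _ => hRw j]
    have h1 : W'.sum = ∑ j, (V j).sum := by rw [← hVsum, finset_sum_multiset_sum]
    have h2 := hS.2.2
    rwa [h1, Prod.fst_sum, Prod.snd_sum] at h2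
  obtain ⟨Q, hQsum, hQw⟩ := exists_sum_of_map_eq_sum _ _ hQ
  replace hQw := fun j => hQw j (Finset.mem_univ j)
  have hneg1 : ∀ j, ∀ g ∈ (V j).sum.1, g < 0 := fun j g hg => hL g ((hVE j).1 g hg)
  have hneg2 : ∀ j, ∀ g ∈ (V j).sum.2, g < 0 := fun j g hg => hL g ((hVE j).2.1 g hg)
  have hAw : ∀ j, (A j).map w = (V j).sum.1 + (B j).map w := fun j => by
    rw [← hRB, Multiset.map_add, hRw]
  have hA'w : ∀ j, (B j + Q j).map w = (B j).map w + (V j).sum.2 := fun j => by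
    rw [Multiset.map_add, hQw]
  have hV0 : ∀ j, V j = 0 → R j = 0 ∧ Q j = 0 := fun j h => by
    have h1 := hRw j
    have h2 := hQw j
    rw [h] at h1 h2
    exact ⟨Multiset.map_eq_zero.mp h1, Multiset.map_eq_zero.mp h2⟩
  have hA' : ∀ j, V j = 0 → B j + Q j = A j := fun j h => by
    rw [← hRB, (hV0 j h).1, (hV0 j h).2, zero_add, add_zero]
  have hatom := fun j => (mem_atoms_iff (saturated_zeroWeight w)).mp (hA j)
  refine ⟨V, hV, hVsum, fun j => B j + Q j, fun j => ?_, fun j h => ?_, ?_, fun j => ?_,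
    fun j => ?_, hA', fun j f hf hfs hVj => ?_⟩
  · have h1 := (mem_zeroWeight w).mp (hatom j).1
    rw [hAw, Multiset.sum_add] at h1
    rw [mem_zeroWeight, hA'w, Multiset.sum_add, ← (hVE j).2.2, add_comm]
    exact h1
  · by_cases hVj : V j = 0
    · exact (hatom j).2.1 ((hA' j hVj).symm.trans h)
    · obtain ⟨e, he⟩ := Multiset.exists_mem_of_ne_zero hVj
      refine snd_ne_zero_of_mem_atoms hL (hW j e (Multiset.mem_of_le (hV j) he)) ?_
      have h1 := snd_le_sum he
      rw [← hQw, (add_eq_zero.mp h).2, Multiset.map_zero] at h1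
      exact Multiset.le_zero.mp h1
  · rw [Finset.sum_add_distrib, hQsum, ← Finset.sum_add_distrib]
    exact Finset.sum_congr rfl fun j _ => by rw [add_comm, hRB]
  · rw [hA'w, hAw, posSeq_add, posSeq_add, posSeq_of_neg (hneg1 j), posSeq_of_neg (hneg2 j),
      add_zero, zero_add]
  · rw [hA'w, hAw, negSeq_add, negSeq_add, negSeq_of_neg (hneg1 j), negSeq_of_neg (hneg2 j)]
    abel
  -- With more than `|Q j|` factors, one of them would avoid `Q j` and lie in `B j`, which is a
  -- proper part of the atom `A j` because `R j` is nonempty.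
  · by_contra! hlt
    have hQc : Multiset.card (Q j) < Multiset.card f := by
      refine lt_of_le_of_lt ?_ hlt
      rw [← Multiset.card_map w, hQw]
      exact card_snd_sum_le fun e he => hm j e (Multiset.mem_of_le (hV j) he)
    obtain ⟨c, hc, hcB⟩ := exists_le_of_card_lt hfs.le hQc
    have hca := (mem_atoms_iff (saturated_zeroWeight w)).mp (hf c hc)
    have hcA : c ≤ A j := hcB.trans (by rw [← hRB]; exact Multiset.le_add_left _ _)
    rcases (hatom j).2.2 c hca.1 hcA with h | h
    · exact hca.2.1 h
    · rw [h, ← hRB] at hcB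
      have hR0 : R j = 0 := by
        have := Multiset.card_le_card hcB
        rw [Multiset.card_add] at this
        exact Multiset.card_eq_zero.mp (by omega)
      obtain ⟨e, he⟩ := Multiset.exists_mem_of_ne_zero hVj
      refine fst_ne_zero_of_mem_atoms hL (hW j e (Multiset.mem_of_le (hV j) he)) ?_
      have h1 := fst_le_sum he
      rw [← hRw, hR0, Multiset.map_zero] at h1
      exact Multiset.le_zero.mp h1

/-- Only indices with `V j ≠ 0` contribute to the distance, and their number is at most the total
number of exchanged atoms of `ℰ`. -/
theorem dist_exchange_le {A : J → Multiset P} {V : J → Multiset (Multiset ℤ × Multiset ℤ)}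
    {f : J → Multiset (Multiset P)} {m : ℕ} (hm : 1 ≤ m) (h0 : ∀ j, V j = 0 → f j = {A j})
    (h1 : ∀ j, V j ≠ 0 → Multiset.card (f j) ≤ m * Multiset.card (V j)) :
    dist (Finset.univ.val.map A) (∑ j, f j) ≤ m * Multiset.card (∑ j, V j) := by
  classical
  refine (dist_sum_le (Finset.univ.filter fun j => V j ≠ 0) A f
    fun j hj => h0 j (by simpa using hj)).trans ?_
  have h2 : ∑ j ∈ Finset.univ.filter (fun j => V j ≠ 0), Multiset.card (V j) ≤
      Multiset.card (∑ j, V j) := by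
    rw [Multiset.card_sum]
    exact Finset.sum_le_sum_of_subset (Finset.filter_subset _ _)
  refine max_le ?_ ?_
  · rw [Finset.card_eq_sum_ones]
    refine le_trans (Finset.sum_le_sum fun j hj => ?_) (h2.trans (Nat.le_mul_of_pos_left _ hm))
    exact Multiset.card_pos.mpr (Finset.mem_filter.mp hj).2
  · refine le_trans (Finset.sum_le_sum fun j hj => h1 j (Finset.mem_filter.mp hj).2) ?_
    rw [← Finset.mul_sum]
    exact Nat.mul_le_mul_left m h2

/-- Either the negative parts of the atoms `A j` can be transformed into the sequences `T j` by a
chain of factorizations, or a chain leads to a factorization with a strict refinement. -/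
theorem exists_chain_or_refinement (hL : ∀ g ∈ L, g < 0) {D m : ℕ}
    (hD : ∀ z : Multiset (Multiset ℤ × Multiset ℤ), z ≠ 0 →
      (∀ u ∈ z, u ∈ atoms (equalSumPairs L)) → z.sum ∈ symmPairs L →
      ∃ z' ≤ z, z' ≠ 0 ∧ z'.sum ∈ symmPairs L ∧ Multiset.card z' ≤ D)
    {A : J → Multiset P} (hA : ∀ j, A j ∈ atoms (zeroWeight w))
    {W : J → Multiset (Multiset ℤ × Multiset ℤ)}
    (hW : ∀ j, ∀ e ∈ W j, e ∈ atoms (equalSumPairs L))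
    (hm : ∀ j, ∀ e ∈ W j, Multiset.card e.2 ≤ m) {C T : J → Multiset ℤ}
    (hC : ∀ j, negSeq ((A j).map w) = (W j).sum.1 + C j) (hT : ∀ j, T j = (W j).sum.2 + C j)
    (hS : (∑ j, W j).sum ∈ symmPairs L) :
    (∃ A' : J → Multiset P, Relation.ReflTransGen (Step w (min D (m * D)))
        (Finset.univ.val.map A) (Finset.univ.val.map A') ∧
        (∀ j, A' j ∈ atoms (zeroWeight w)) ∧
        ∀ j, posSeq ((A' j).map w) = posSeq ((A j).map w) ∧ negSeq ((A' j).map w) = T j) ∨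
      ∃ z₁ z₂ : Multiset (Multiset P), Relation.ReflTransGen (Step w (min D (m * D)))
        (Finset.univ.val.map A) z₁ ∧ (∀ U ∈ z₂, U ∈ atoms (zeroWeight w)) ∧ z₂.sum = z₁.sum ∧
        Multiset.card z₁ < Multiset.card z₂ ∧ dist z₁ z₂ ≤ m * D ∧
        PosLE (posOf w z₁) (posOf w z₂) := by
  -- Induction on the number of atoms of `ℰ` still to be exchanged. `C j` holds the negative terms
  -- of `A j` that are already final; the target `T j` stays fixed.
  induction hn : Multiset.card (∑ j, W j) using Nat.strong_induction_on generalizing A W C with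
  | _ n ih =>
  by_cases hW0 : ∑ j, W j = 0
  · refine Or.inl ⟨A, .refl, hA, fun j => ⟨rfl, ?_⟩⟩
    have h0 : W j = 0 := by
      rw [Finset.sum_eq_zero_iff] at hW0
      exact hW0 j (Finset.mem_univ j)
    rw [hC, hT, h0]
    rfl
  obtain ⟨W', hW', hW'0, hW'S, hcard⟩ := hD _ hW0 (fun u hu => by
    obtain ⟨j, -, hj⟩ := Multiset.mem_sum.mp hu
    exact hW j u hj) hS
  -- Once there is something to exchange, `m` is positive and hence `D ≤ m * D`. The value `m = 0`
  -- can occur only when no step is made.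
  have hm1 : 1 ≤ m := by
    obtain ⟨e, he⟩ := Multiset.exists_mem_of_ne_zero hW0
    obtain ⟨j, -, hj⟩ := Multiset.mem_sum.mp he
    exact (Multiset.card_pos.mpr (snd_ne_zero_of_mem_atoms hL (hW j e hj))).trans_le (hm j e hj)
  obtain ⟨V, hVle, hVsum, A', hA'z, hA'0, hA's, hpos, hneg, hVA, hf⟩ := exists_exchange hL hA hW
    (fun j => by rw [hC]; exact Multiset.le_add_right _ _) hm hW' hW'S
  by_cases hat : ∀ j, A' j ∈ atoms (zeroWeight w)
  · have hstep : Step w (min D (m * D)) (Finset.univ.val.map A) (Finset.univ.val.map A') := by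
      refine ⟨fun U hU => ?_, hA's, ?_, ?_⟩
      · obtain ⟨j, -, rfl⟩ := Multiset.mem_map.mp hU
        exact hat j
      · rw [posOf, posOf, Multiset.map_map, Multiset.map_map]
        exact Multiset.map_congr rfl fun j _ => hpos j
      · have h1 := dist_exchange_le (A := A) (V := V) (f := fun j => {A' j}) le_rfl
          (fun j hj => by rw [hVA j hj]) (fun j hj => by
            rw [one_mul]
            exact Multiset.card_pos.mpr hj)
        rw [one_mul, sum_singleton_eq_map, hVsum] at h1
        have h2 := h1.trans hcard
        exact le_min h2 (h2.trans (Nat.le_mul_of_pos_left D hm1))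
    have hU : ∀ j, ∃ U, W j = V j + U := fun j => Multiset.le_iff_exists_add.mp (hVle j)
    choose U hU using hU
    have hUW : ∀ j, U j ≤ W j := fun j => by rw [hU]; exact Multiset.le_add_left _ _
    have hsum : ∑ j, W j = W' + ∑ j, U j := by
      rw [← hVsum, ← Finset.sum_add_distrib]
      exact Finset.sum_congr rfl fun j _ => hU j
    have hUS : (∑ j, U j).sum ∈ symmPairs L := by
      rw [hsum, Multiset.sum_add] at hS
      refine ⟨fun g hg => hS.1 g (Multiset.mem_add.mpr (Or.inr hg)),
        fun g hg => hS.2.1 g (Multiset.mem_add.mpr (Or.inr hg)), ?_⟩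
      have h1 := hS.2.2
      rw [Prod.fst_add, Prod.snd_add, hW'S.2.2] at h1
      exact add_left_cancel h1
    have hlt : Multiset.card (∑ j, U j) < n := by
      rw [← hn, hsum, Multiset.card_add]
      have := Multiset.card_pos.mpr hW'0
      omega
    rcases ih _ hlt hat (W := U) (C := fun j => C j + (V j).sum.2)
      (fun j e he => hW j e (Multiset.mem_of_le (hUW j) he))
      (fun j e he => hm j e (Multiset.mem_of_le (hUW j) he)) (fun j => by
        refine add_right_cancel (b := (V j).sum.1) ?_
        rw [hneg, hC, hU, Multiset.sum_add, Prod.fst_add]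
        abel) (fun j => by
        rw [hT, hU, Multiset.sum_add, Prod.snd_add]
        abel) hUS rfl with ⟨A'', h1, h2, h3⟩ | ⟨z₁, z₂, h1, h2⟩
    · exact Or.inl ⟨A'', h1.head hstep, h2, fun j => ⟨(h3 j).1.trans (hpos j), (h3 j).2⟩⟩
    · exact Or.inr ⟨z₁, z₂, h1.head hstep, h2⟩
  · right
    push Not at hat
    obtain ⟨k, hk⟩ := hat
    -- All `A' j` are factored. The index `k` contributes at least two atoms, so the length grows;
    -- each `A' j` has the positive part of `A j`, so the atoms of `f j` refine that part.
    choose f hfa hfs using fun j => exists_factorization (saturated_zeroWeight w) (hA'z j)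
    have hf1 : ∀ j, 1 ≤ Multiset.card (f j) := fun j => by
      refine Multiset.card_pos.mpr fun h => hA'0 j ?_
      rw [← hfs, h, Multiset.sum_zero]
    refine ⟨_, ∑ j, f j, .refl, fun U hU => ?_, ?_, ?_, ?_,
      Finset.univ.val.map fun j => posOf w (f j), ?_, ?_⟩
    · obtain ⟨j, -, hj⟩ := Multiset.mem_sum.mp hU
      exact hfa j U hj
    · rw [finset_sum_multiset_sum, Finset.sum_congr rfl fun j _ => hfs j, hA's]
      rfl
    · rw [Multiset.card_map, Multiset.card_sum]
      change Finset.univ.card < _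
      rw [Finset.card_eq_sum_ones]
      refine Finset.sum_lt_sum (fun j _ => hf1 j) ⟨k, Finset.mem_univ k, ?_⟩
      refine lt_of_le_of_ne (hf1 k) fun h => hk ?_
      obtain ⟨u, hu⟩ := Multiset.card_eq_one.mp h.symm
      rw [← hfs, hu, Multiset.sum_singleton]
      exact hfa k u (by simp [hu])
    · refine (dist_exchange_le hm1 (fun j hj => ?_) fun j hj => hf j _ (hfa j) (hfs j) hj).trans ?_
      · have h1 := eq_singleton_of_sum_mem_atoms (hfa j) (by rw [hfs, hVA j hj]; exact hA j)
        rw [h1, hfs, hVA j hj]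
      · rw [hVsum]
        exact Nat.mul_le_mul_left m hcard
    · rw [Multiset.map_map, posOf, Multiset.map_map]
      refine Multiset.map_congr rfl fun j _ => ?_
      simp only [Function.comp_apply]
      rw [sum_posOf, hfs, hpos]
    · rw [posOf_finset_sum]
      rfl

end Steps

/-! ### Chains of factorizations of sequences over `P` -/

section Chains

variable {P J : Type*} {w : P → ℤ}

theorem chain_mono {α : Type*} {r p : α → α → Prop} (h : ∀ a b, r a b → p a b) {a b : α}
    (hab : Relation.ReflTransGen r a b) : Relation.ReflTransGen p a b :=
  Relation.ReflTransGen.lift id h _ _ hab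

/-- Two families of atoms with the same weights and the same product are connected by a chain of
steps that exchange two elements. -/
theorem exists_chain_of_map_eq [Fintype J] {A B : J → Multiset P}
    (hA : ∀ j, A j ∈ atoms (zeroWeight w)) (hAB : ∀ j, (A j).map w = (B j).map w)
    (hsum : ∑ j, A j = ∑ j, B j) :
    Relation.ReflTransGen (Step w 2) (Finset.univ.val.map A) (Finset.univ.val.map B) := by
  classical
  -- The measure counts the elements of the `B j` still missing from the `A j`.
  induction hn : ∑ j, Multiset.card (B j - A j) using Nat.strong_induction_on generalizing A with
  | _ n ih =>
  by_cases h0 : ∀ j, B j - A j = 0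
  · have h1 : A = B := funext fun j => by
      have h2 : Multiset.card (A j) = Multiset.card (B j) := by
        rw [← Multiset.card_map w, hAB, Multiset.card_map]
      exact (Multiset.eq_of_le_of_card_le (tsub_eq_zero_iff_le.mp (h0 j)) h2.le).symm
    rw [h1]
  push Not at h0
  obtain ⟨j, hj⟩ := h0
  obtain ⟨p, hp⟩ := Multiset.exists_mem_of_ne_zero hj
  have hpj : (A j).count p < (B j).count p := by
    have := Multiset.count_pos.mpr hp
    rw [Multiset.count_sub] at this
    omega
  -- A deficit of `p` at `j` forces a surplus of `p` at some `k`, the total products being equal.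
  -- Equality of weights then provides a surplus `q` in `A j` of the same class as `p`.
  obtain ⟨k, hk⟩ : ∃ k, (B k).count p < (A k).count p := by
    by_contra! hall
    have h1 := Finset.sum_lt_sum (fun i _ => hall i) ⟨j, Finset.mem_univ j, hpj⟩
    rw [← Multiset.count_sum', ← Multiset.count_sum', hsum] at h1
    exact lt_irrefl _ h1
  have hkj : k ≠ j := by
    rintro rfl
    exact lt_asymm hpj hk
  obtain ⟨q, hq, hqp⟩ : ∃ q ∈ A j - B j, w q = w p := by
    have h1 : (A j - B j).map w = (B j - A j).map w := by
      refine add_right_cancel (b := (A j ∩ B j).map w) ?_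
      rw [← Multiset.map_add, ← Multiset.map_add, Multiset.sub_add_inter, Multiset.inter_comm,
        Multiset.sub_add_inter, hAB]
    have h2 : w p ∈ (A j - B j).map w := by rw [h1]; exact Multiset.mem_map_of_mem w hp
    exact Multiset.mem_map.mp h2
  have hqj : (B j).count q < (A j).count q := by
    have := Multiset.count_pos.mpr hq
    rw [Multiset.count_sub] at this
    omega
  obtain ⟨X, hX⟩ := Multiset.exists_cons_of_mem (Multiset.count_pos.mp (pos_of_gt hqj))
  obtain ⟨Y, hY⟩ := Multiset.exists_cons_of_mem (Multiset.count_pos.mp (pos_of_gt hk))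
  -- `A j` and `A k` swap `q` against `p`. All weights are preserved, so the factors remain atoms.
  let A' : J → Multiset P := Function.update (Function.update A j (p ::ₘ X)) k (q ::ₘ Y)
  have hA'k : A' k = q ::ₘ Y := Function.update_self ..
  have hA'j : A' j = p ::ₘ X := by
    simp only [A', Function.update_of_ne hkj.symm, Function.update_self]
  have hA'i : ∀ i, i ≠ j → i ≠ k → A' i = A i := fun i hij hik => by
    simp only [A', Function.update_of_ne hik, Function.update_of_ne hij]
  have hA'w : ∀ i, (A' i).map w = (A i).map w := fun i => by
    by_cases hik : i = k
    · rw [hik, hA'k, hY, Multiset.map_cons, Multiset.map_cons, hqp]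
    · by_cases hij : i = j
      · rw [hij, hA'j, hX, Multiset.map_cons, Multiset.map_cons, hqp]
      · rw [hA'i i hij hik]
  have hA'a : ∀ i, A' i ∈ atoms (zeroWeight w) := fun i => by
    rw [← map_mem_atoms_iff, hA'w, map_mem_atoms_iff]
    exact hA i
  have hsplit : ∀ f : J → Multiset P, ∑ i, f i = f j + f k + ∑ i ∈ ({j, k} : Finset J)ᶜ, f i := by
    intro f
    rw [← Finset.sum_add_sum_compl {j, k} f, Finset.sum_pair hkj.symm]
  have hA's : ∑ i, A' i = ∑ i, A i := by
    rw [hsplit A', hsplit A, hA'j, hA'k, hX, hY]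
    congr 1
    · simp only [Multiset.cons_add, Multiset.add_cons]
      rw [Multiset.cons_swap]
    · refine Finset.sum_congr rfl fun i hi => ?_
      simp only [Finset.mem_compl, Finset.mem_insert, Finset.mem_singleton, not_or] at hi
      exact hA'i i hi.1 hi.2
  have hstep : Step w 2 (Finset.univ.val.map A) (Finset.univ.val.map A') := by
    refine ⟨fun U hU => ?_, hA's, ?_, ?_⟩
    · obtain ⟨i, -, rfl⟩ := Multiset.mem_map.mp hU
      exact hA'a i
    · rw [posOf, posOf, Multiset.map_map, Multiset.map_map]
      refine Multiset.map_congr rfl fun i _ => ?_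
      simp only [Function.comp_apply, hA'w]
    · have h1 := dist_sum_le {j, k} A (fun i => {A' i}) fun i hi => by
        simp only [Finset.mem_insert, Finset.mem_singleton, not_or] at hi
        rw [hA'i i hi.1 hi.2]
      rw [sum_singleton_eq_map] at h1
      simpa [Finset.card_pair hkj.symm] using h1
  refine Relation.ReflTransGen.head hstep (ih _ ?_ hA'a (fun i => (hA'w i).trans (hAB i))
    (hA's.trans hsum) rfl)
  rw [← hn]
  -- At `j` one missing `p` is supplied and only a surplus `q` is lost; at `k` only a surplus `p` is
  -- lost. The measure drops at `j` and grows nowhere.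
  refine Finset.sum_lt_sum (fun i _ => ?_) ⟨j, Finset.mem_univ j, ?_⟩
  · refine Multiset.card_le_card (Multiset.le_iff_count.mpr fun x => ?_)
    by_cases hik : i = k
    · subst hik
      rw [hA'k, Multiset.count_sub, Multiset.count_sub, hY, Multiset.count_cons,
        Multiset.count_cons]
      rw [hY, Multiset.count_cons_self] at hk
      by_cases hxp : x = p
      · subst hxp
        simp only [if_true]
        omega
      · simp only [if_neg hxp]
        omega
    · by_cases hij : i = j
      · subst hij
        rw [hA'j, Multiset.count_sub, Multiset.count_sub, hX, Multiset.count_cons,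
          Multiset.count_cons]
        rw [hX, Multiset.count_cons_self] at hqj
        by_cases hxq : x = q
        · subst hxq
          simp only [if_true]
          omega
        · simp only [if_neg hxq]
          omega
      · rw [hA'i i hij hik]
  · have h1 : B j - A' j = (B j - A j).erase p := by
      ext x
      rw [hA'j, Multiset.count_sub, hX]
      rw [hX, Multiset.count_cons_self] at hqj
      by_cases hxp : x = p
      · subst hxp
        rw [Multiset.count_erase_self, Multiset.count_cons_self, Multiset.count_sub,
          Multiset.count_cons]
        split_ifs with hxq
        · subst hxq
          omega
        · omega
      · rw [Multiset.count_erase_of_ne hxp, Multiset.count_cons_of_ne hxp, Multiset.count_sub,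
          Multiset.count_cons]
        split_ifs with hxq
        · subst hxq
          omega
        · omega
    rw [h1]
    exact Multiset.card_erase_lt_of_mem hp

/-- The property that defines an upper bound for `D(𝒮(L), ℰ(L))`. -/
def DavenportBound (L : Set ℤ) (D : ℕ) : Prop :=
  ∀ z : Multiset (Multiset ℤ × Multiset ℤ), z ≠ 0 →
    (∀ u ∈ z, u ∈ atoms (equalSumPairs L)) → z.sum ∈ symmPairs L →
    ∃ z' ≤ z, z' ≠ 0 ∧ z'.sum ∈ symmPairs L ∧ Multiset.card z' ≤ D

theorem negSeq_mem_seqs {G : Set ℤ} {S : Multiset ℤ} (h : S ∈ seqs G) :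
    negSeq S ∈ seqs (negPart G) :=
  fun g hg => ⟨h g (Multiset.mem_filter.mp hg).1, (Multiset.mem_filter.mp hg).2⟩

/-- Equal positive parts and vanishing sums put the pairs of negative parts of `A j` and `B j` into
`ℰ`; equality of the total products makes their sum symmetric. `M` bounds the second components of
the atoms that occur. -/
theorem exists_chain_to_pattern [Fintype J] {D M : ℕ}
    (hD : DavenportBound (negPart (Set.range w)) D) {A : J → Multiset P}
    (hA : ∀ j, A j ∈ atoms (zeroWeight w)) {B : J → Multiset ℤ}
    (hB : ∀ j, B j ∈ zeroSumSeqs (Set.range w))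
    (hpos : ∀ j, posSeq ((A j).map w) = posSeq (B j)) (hsum : ∑ j, B j = (∑ j, A j).map w)
    (hM : ∀ g ∈ (∑ j, A j).map w, g < 0 → -(M : ℤ) ≤ g) :
    (∃ A' : J → Multiset P, Relation.ReflTransGen (Step w (min D (M * D)))
        (Finset.univ.val.map A) (Finset.univ.val.map A') ∧
        (∀ j, A' j ∈ atoms (zeroWeight w)) ∧
        ∀ j, posSeq ((A' j).map w) = posSeq (B j) ∧ negSeq ((A' j).map w) = negSeq (B j)) ∨
      ∃ z₁ z₂ : Multiset (Multiset P), Relation.ReflTransGen (Step w (min D (M * D)))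
        (Finset.univ.val.map A) z₁ ∧ (∀ U ∈ z₂, U ∈ atoms (zeroWeight w)) ∧ z₂.sum = z₁.sum ∧
        Multiset.card z₁ < Multiset.card z₂ ∧ dist z₁ z₂ ≤ M * D ∧
        PosLE (posOf w z₁) (posOf w z₂) := by
  have hL : ∀ g ∈ negPart (Set.range w), g < 0 := fun g hg => hg.2
  have hAz : ∀ j, (A j).map w ∈ zeroSumSeqs (Set.range w) := fun j =>
    (map_mem_atoms_iff.mpr (hA j)).1
  have hE : ∀ j, (negSeq ((A j).map w), negSeq (B j)) ∈ equalSumPairs (negPart (Set.range w)) :=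
    fun j => ⟨negSeq_mem_seqs (hAz j).1, negSeq_mem_seqs (hB j).1, by
      have h1 := posSeq_sum_add_negSeq_sum ((A j).map w)
      have h2 := posSeq_sum_add_negSeq_sum (B j)
      rw [(hAz j).2, hpos] at h1
      rw [(hB j).2] at h2
      simp only
      linarith⟩
  choose W hW hWs using fun j => exists_factorization (saturated_equalSumPairs _) (hE j)
  have hW1 : ∀ j, (W j).sum.1 = negSeq ((A j).map w) := fun j => by rw [hWs]
  have hW2 : ∀ j, (W j).sum.2 = negSeq (B j) := fun j => by rw [hWs]
  have hm : ∀ j, ∀ e ∈ W j, Multiset.card e.2 ≤ M := fun j e he => by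
    refine card_snd_le_of_mem_atoms hL (hW j e he) fun g hg => ?_
    have h1 := Multiset.mem_of_le (fst_le_sum he) hg
    rw [hW1] at h1
    obtain ⟨h2, h3⟩ := Multiset.mem_filter.mp h1
    refine hM g ?_ h3
    rw [map_finset_sum]
    exact Multiset.mem_sum.mpr ⟨j, Finset.mem_univ j, h2⟩
  have h1 : (∑ j, W j).sum.1 = negSeq ((∑ j, A j).map w) := by
    rw [finset_sum_multiset_sum, Prod.fst_sum, Finset.sum_congr rfl fun j _ => hW1 j,
      ← negSeq_finset_sum, map_finset_sum]
  have h2 : (∑ j, W j).sum.2 = negSeq ((∑ j, A j).map w) := by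
    rw [finset_sum_multiset_sum, Prod.snd_sum, Finset.sum_congr rfl fun j _ => hW2 j,
      ← negSeq_finset_sum, hsum]
  have hmem := sum_mem_of_atoms (V := ∑ j, W j) fun e he => by
    obtain ⟨j, -, hj⟩ := Multiset.mem_sum.mp he
    exact hW j e hj
  have hS : (∑ j, W j).sum ∈ symmPairs (negPart (Set.range w)) :=
    ⟨hmem.1, hmem.2.1, h1.trans h2.symm⟩
  have key := exists_chain_or_refinement hL hD hA hW hm (C := fun _ => 0)
    (T := fun j => negSeq (B j)) (fun j => by rw [hW1, add_zero]) (fun j => by rw [hW2, add_zero])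
    hS
  simp only [hpos] at key
  exact key

/-- `z⁺` is maximal among the positive parts of the factorizations of the block of `z`. -/
def IsMaxPos (w : P → ℤ) (z : Multiset (Multiset P)) : Prop :=
  ∀ y ∈ seqFactorizations (Set.range w) (z.sum.map w),
    PosLE (posOf w z) (posFact y) → posFact y = posOf w z

theorem sum_map_map (z : Multiset (Multiset P)) :
    (z.map (Multiset.map w)).sum = z.sum.map w :=
  (map_multiset_sum (Multiset.mapAddMonoidHom w) z).symm

theorem map_mem_seqFactorizations {z : Multiset (Multiset P)}
    (hz : ∀ U ∈ z, U ∈ atoms (zeroWeight w)) :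
    z.map (Multiset.map w) ∈ seqFactorizations (Set.range w) (z.sum.map w) := by
  refine ⟨fun U hU => ?_, sum_map_map z⟩
  obtain ⟨X, hX, rfl⟩ := Multiset.mem_map.mp hU
  exact map_mem_atoms_iff.mpr (hz X hX)

/-- If a product of atoms has the same positive and negative part as an atom, it has at most one
factor with nonempty positive part. -/
theorem count_map_posSeq {G : Set ℤ} {v : Multiset (Multiset ℤ)}
    (hv : ∀ U ∈ v, U ∈ atoms (zeroSumSeqs G)) {B : Multiset ℤ} (hB : B ∈ atoms (zeroSumSeqs G))
    (hp : posSeq B = posSeq v.sum) (hn : negSeq B = negSeq v.sum) {x : Multiset ℤ} (hx : x ≠ 0) :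
    (v.map posSeq).count x = ({posSeq B} : Multiset (Multiset ℤ)).count x := by
  have hzero : ∀ v' : Multiset (Multiset ℤ), posSeq v'.sum = 0 → (v'.map posSeq).count x = 0 := by
    intro v' h
    rw [Multiset.count_eq_zero]
    intro hmem
    rw [posSeq_sum] at h
    exact hx (Multiset.sum_eq_zero_iff.mp h x hmem)
  by_cases h : ∃ U ∈ v, posSeq U ≠ 0
  · obtain ⟨U, hU, hU0⟩ := h
    obtain ⟨v', rfl⟩ := Multiset.exists_cons_of_mem hU
    rw [Multiset.sum_cons, posSeq_add] at hp
    rw [Multiset.sum_cons, negSeq_add] at hn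
    have hUa := hv U hU
    have hUd := (eq_or_eq_singleton_zero hUa).resolve_right fun h' =>
      hU0 ((posSeq_eq_zero_iff hUa).mpr h')
    -- A factor with nonempty positive part lies inside the atom `B` and so equals it; nothing
    -- positive is left for the other factors.
    have hle : U ≤ B := by
      rw [← hUd.1, ← posSeq_add_negSeq_add B, hp, hn]
      refine (add_le_add (Multiset.le_add_right _ (posSeq v'.sum))
        (Multiset.le_add_right _ (negSeq v'.sum))).trans (Multiset.le_add_right _ _)
    have hUB : U = B := by
      have hUm := (mem_atoms_iff (saturated_zeroSumSeqs G)).mp hUa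
      exact (((mem_atoms_iff (saturated_zeroSumSeqs G)).mp hB).2.2 U hUm.1 hle).resolve_left hUm.2.1
    rw [← hUB] at hp ⊢
    have hv' : posSeq v'.sum = 0 := by simpa using hp
    rw [Multiset.map_cons, ← Multiset.singleton_add, Multiset.count_add, hzero v' hv', add_zero]
  · push Not at h
    have h0 : posSeq v.sum = 0 := by
      rw [posSeq_sum]
      refine Multiset.sum_eq_zero fun y hy => ?_
      obtain ⟨U, hU, rfl⟩ := Multiset.mem_map.mp hy
      exact h U hU
    rw [hzero v h0, hp, h0, Multiset.count_singleton, if_neg hx]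

/-- The chain is aimed at a factorization `y` with `z⁺ ≤ y⁺` and `y⁺ ≠ z⁺`. If its pattern could be
reached by atoms, each group of `y` would have the positive and negative part of one atom, hence a
single factor with nonempty positive part, and `y⁺ = z⁺` would follow. -/
theorem exists_refinement {D M : ℕ} (hD : DavenportBound (negPart (Set.range w)) D)
    {z : Multiset (Multiset P)} (hz : ∀ U ∈ z, U ∈ atoms (zeroWeight w))
    (hM : ∀ g ∈ z.sum.map w, g < 0 → -(M : ℤ) ≤ g) (hmax : ¬ IsMaxPos w z) :
    ∃ z₁ z₂ : Multiset (Multiset P), Relation.ReflTransGen (Step w (min D (M * D))) z z₁ ∧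
      (∀ U ∈ z₂, U ∈ atoms (zeroWeight w)) ∧ z₂.sum = z₁.sum ∧
      Multiset.card z₁ < Multiset.card z₂ ∧ dist z₁ z₂ ≤ M * D ∧
      PosLE (posOf w z₁) (posOf w z₂) := by
  classical
  unfold IsMaxPos at hmax
  push Not at hmax
  obtain ⟨y, ⟨hya, hys⟩, ⟨ω₀, hω₀, hω₀s⟩, hne⟩ := hmax
  obtain ⟨n, A, rfl⟩ := exists_fin_family z
  have hA : ∀ j, A j ∈ atoms (zeroWeight w) := fun j =>
    hz _ (Multiset.mem_map_of_mem A (Finset.mem_univ j))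
  rw [posOf, Multiset.map_map] at hω₀
  obtain ⟨ω, rfl, hω⟩ := exists_family_of_map_eq hω₀
  obtain ⟨v, hvs, hv⟩ := exists_sum_of_map_eq_sum Finset.univ ω hω₀s.symm
  replace hv := fun j => hv j (Finset.mem_univ j)
  have hva : ∀ j, ∀ U ∈ v j, U ∈ atoms (zeroSumSeqs (Set.range w)) := fun j U hU =>
    hya U (by rw [← hvs]; exact Multiset.mem_sum.mpr ⟨j, Finset.mem_univ j, hU⟩)
  have hpos : ∀ j, posSeq ((A j).map w) = posSeq (v j).sum := fun j => by
    rw [posSeq_sum, hv, hω]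
    rfl
  rcases exists_chain_to_pattern hD hA (B := fun j => (v j).sum)
    (fun j => sum_mem_of_atoms (hva j)) hpos (by
      rw [← finset_sum_multiset_sum, hvs, hys]
      rfl) hM with ⟨A', -, hA', hA'p⟩ | h
  · refine absurd ?_ hne
    ext x
    -- `PosLE` leaves the number of empty sequences free, so these are counted separately: they come
    -- from the atom `{0}` alone, and their number is read off from the product.
    by_cases hx : x = 0
    · have h1 := map_mem_seqFactorizations hz
      rw [hx, count_zero_posFact hya, hys, posOf_eq, count_zero_posFact h1.1, h1.2]
    · rw [posFact, ← hvs]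
      have h1 : (∑ j, v j).map posSeq = ∑ j, (v j).map posSeq :=
        map_sum (Multiset.mapAddMonoidHom posSeq) v Finset.univ
      have h2 : posOf w (Finset.univ.val.map A) =
          ∑ j, ({posSeq ((A j).map w)} : Multiset (Multiset ℤ)) := by
        rw [sum_singleton_eq_map, posOf, Multiset.map_map]
        rfl
      rw [h1, h2, Multiset.count_sum', Multiset.count_sum']
      refine Finset.sum_congr rfl fun j _ => ?_
      rw [count_map_posSeq (hva j) (map_mem_atoms_iff.mpr (hA' j)) (hA'p j).1 (hA'p j).2 hx,
        hpos, (hA'p j).1]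
  · exact h

/-- One step of a chain of factorizations with increasing positive parts. -/
def IncStep (w : P → ℤ) (d : ℕ) (z z' : Multiset (Multiset P)) : Prop :=
  (∀ U ∈ z', U ∈ atoms (zeroWeight w)) ∧ z'.sum = z.sum ∧ Multiset.card z ≤ Multiset.card z' ∧
    dist z z' ≤ d ∧ PosLE (posOf w z) (posOf w z')

theorem PosLE.refl (p : Multiset (Multiset ℤ)) : PosLE p p :=
  ⟨p.map fun x => {x}, by simp [Multiset.map_map], Multiset.sum_map_singleton p⟩

theorem card_eq_of_posOf_eq {z z' : Multiset (Multiset P)} (h : posOf w z = posOf w z') :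
    Multiset.card z = Multiset.card z' := by
  simpa [posOf] using congrArg Multiset.card h

theorem Step.incStep {d : ℕ} {z z' : Multiset (Multiset P)} (h : Step w d z z') :
    IncStep w d z z' :=
  ⟨h.1, h.2.1, (card_eq_of_posOf_eq h.2.2.1).ge, h.2.2.2, h.2.2.1 ▸ PosLE.refl _⟩

theorem card_le_card_sum {z : Multiset (Multiset P)} (hz : ∀ U ∈ z, U ∈ atoms (zeroWeight w)) :
    Multiset.card z ≤ Multiset.card z.sum := by
  induction z using Multiset.induction with
  | empty => simp
  | cons U z ih =>
    have h1 := ih fun V hV => hz V (Multiset.mem_cons_of_mem hV)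
    have h2 := Multiset.card_pos.mpr
      ((mem_atoms_iff (saturated_zeroWeight w)).mp (hz U (Multiset.mem_cons_self U z))).2.1
    rw [Multiset.sum_cons, Multiset.card_cons, Multiset.card_add]
    omega

/-- Each refinement lengthens the factorization, and the length never exceeds the number of terms of
the product, so the process stops at a maximal positive part. -/
theorem exists_chain_to_isMaxPos {D M : ℕ} (hD : DavenportBound (negPart (Set.range w)) D)
    {z : Multiset (Multiset P)} (hz : ∀ U ∈ z, U ∈ atoms (zeroWeight w))
    (hM : ∀ g ∈ z.sum.map w, g < 0 → -(M : ℤ) ≤ g) :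
    ∃ y, Relation.ReflTransGen (IncStep w (M * D)) z y ∧
      (∀ U ∈ y, U ∈ atoms (zeroWeight w)) ∧ y.sum = z.sum ∧ IsMaxPos w y := by
  induction hn : Multiset.card z.sum - Multiset.card z using Nat.strong_induction_on
    generalizing z with
  | _ n ih =>
  by_cases hmax : IsMaxPos w z
  · exact ⟨z, .refl, hz, rfl, hmax⟩
  obtain ⟨z₁, z₂, h1, h2, h3, h4, h5, h6⟩ := exists_refinement hD hz hM hmax
  obtain ⟨-, h7, h8⟩ := chain_invariants h1 hz
  have h9 := card_le_card_sum h2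
  rw [h3, h7] at h9
  rw [← card_eq_of_posOf_eq h8.symm] at h4
  obtain ⟨y, hy, hya, hys, hymax⟩ := ih _ (by rw [h3, h7, ← hn]; omega) h2
    (by rw [h3, h7]; exact hM) rfl
  refine ⟨y, ?_, hya, hys.trans (h3.trans h7), hymax⟩
  refine Relation.ReflTransGen.trans (chain_mono (fun a b h => (h.mono (min_le_right _ _)).incStep) h1) ?_
  refine Relation.ReflTransGen.head ⟨h2, h3, ?_, h5, h6⟩ hy
  rw [← card_eq_of_posOf_eq h8.symm]
  exact h4.le

theorem exists_chain_of_isMaxPos {D : ℕ} (hD : DavenportBound (negPart (Set.range w)) D)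
    {z y : Multiset (Multiset P)} (hz : ∀ U ∈ z, U ∈ atoms (zeroWeight w))
    (hy : ∀ U ∈ y, U ∈ atoms (zeroWeight w)) (hzy : z.sum = y.sum)
    (hpos : posOf w z = posOf w y) (hmax : IsMaxPos w z) :
    Relation.ReflTransGen (Step w (max D 2)) z y := by
  -- Any lower bound for the negative terms will do: `M` enters the distance only when a factor
  -- splits, which maximality excludes.
  obtain ⟨M, hM⟩ : ∃ M : ℕ, ∀ g ∈ z.sum.map w, g < 0 → -(M : ℤ) ≤ g := by
    refine ⟨((z.sum.map w).map Int.natAbs).sum, fun g hg _ => ?_⟩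
    have := Multiset.single_le_sum (fun x _ => Nat.zero_le x) _
      (Multiset.mem_map_of_mem Int.natAbs hg)
    omega
  obtain ⟨n, A, rfl⟩ := exists_fin_family z
  have hA : ∀ j, A j ∈ atoms (zeroWeight w) := fun j =>
    hz _ (Multiset.mem_map_of_mem A (Finset.mem_univ j))
  rw [posOf, Multiset.map_map] at hpos
  obtain ⟨B, rfl, hB⟩ := exists_family_of_map_eq (f := fun U : Multiset P => posSeq (U.map w))
    hpos.symm
  have hBa : ∀ j, B j ∈ atoms (zeroWeight w) := fun j =>
    hy _ (Multiset.mem_map_of_mem B (Finset.mem_univ j))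
  have hsum : ∑ j, A j = ∑ j, B j := hzy
  rcases exists_chain_to_pattern hD hA (B := fun j => (B j).map w)
    (fun j => (map_mem_atoms_iff.mpr (hBa j)).1) (fun j => (hB j).symm)
    (by rw [← map_finset_sum, hsum]) hM with ⟨A', h1, hA', hA'p⟩ | ⟨z₁, z₂, h1, h2, h3, h4, -, h6⟩
  · refine (chain_mono
      (fun a b h => h.mono ((min_le_left _ _).trans (le_max_left _ _))) h1).trans ?_
    refine chain_mono (fun a b h => h.mono (le_max_right _ _))
      (exists_chain_of_map_eq hA' (fun j => ?_) ?_)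
    · exact eq_of_posSeq_eq_of_negSeq_eq (map_mem_atoms_iff.mpr (hA' j))
        (map_mem_atoms_iff.mpr (hBa j)) (hA'p j).1 (hA'p j).2
    · exact (chain_invariants h1 hz).2.1.trans hsum
  -- A refinement would have the same positive parts by maximality, hence the same length, although
  -- it is strictly longer.
  · obtain ⟨-, h7, h8⟩ := chain_invariants h1 hz
    have h9 := hmax (z₂.map (Multiset.map w))
      (by rw [← h7, ← h3]; exact map_mem_seqFactorizations h2) (by rw [← h8, ← posOf_eq]; exact h6)
    rw [← posOf_eq, ← h8] at h9
    exact absurd (card_eq_of_posOf_eq h9) h4.ne'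

theorem exists_chain_function {α : Type*} {r : α → α → Prop} {a b : α}
    (h : Relation.ReflTransGen r a b) :
    ∃ (n : ℕ) (c : ℕ → α), c 0 = a ∧ c n = b ∧ ∀ i < n, r (c i) (c (i + 1)) := by
  induction h using Relation.ReflTransGen.head_induction_on with
  | refl => exact ⟨0, fun _ => b, rfl, rfl, by simp⟩
  | @head a c h _ ih =>
    obtain ⟨n, f, h0, hn, hf⟩ := ih
    refine ⟨n + 1, fun i => Nat.casesOn i a f, rfl, hn, fun i hi => ?_⟩
    cases i with
    | zero => simpa [h0] using h
    | succ i => exact hf i (by omega)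

end Chains

/-! ### From sequences over `P` to the Krull monoid -/

section Transfer

variable {H P : Type*} [CancelCommMonoid H] (φ : H →* Multiplicative (Multiset P))
  (ι : ClassGp φ ≃* Multiplicative ℤ)

/-- The map `H_red → ℱ(P)` induced by `φ`. -/
def primeSeq : Associates H → Multiset P :=
  Quotient.lift (fun a => (φ a).toAdd) fun a b h => by
    obtain ⟨u, rfl⟩ := h
    have h1 : φ (u : H) * φ ((u⁻¹ : Hˣ) : H) = 1 := by
      rw [← map_mul, Units.mul_inv, map_one]
    have h2 : (φ (u : H)).toAdd + (φ ((u⁻¹ : Hˣ) : H)).toAdd = 0 :=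
      congrArg Multiplicative.toAdd h1
    simp [(add_eq_zero.mp h2).1]

theorem primeSeq_mk (a : H) : primeSeq φ (Associates.mk a) = (φ a).toAdd := rfl

theorem primeSeq_one : primeSeq φ 1 = 0 := by
  rw [← Associates.mk_one, primeSeq_mk, map_one]
  rfl

theorem primeSeq_mul (u v : Associates H) :
    primeSeq φ (u * v) = primeSeq φ u + primeSeq φ v := by
  obtain ⟨a, rfl⟩ := Associates.mk_surjective u
  obtain ⟨b, rfl⟩ := Associates.mk_surjective v
  rw [Associates.mk_mul_mk, primeSeq_mk, primeSeq_mk, primeSeq_mk, map_mul]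
  rfl

theorem primeSeq_prod (z : Multiset (Associates H)) :
    primeSeq φ z.prod = (z.map (primeSeq φ)).sum := by
  induction z using Multiset.induction with
  | empty => exact primeSeq_one φ
  | cons u z ih =>
    rw [Multiset.prod_cons, primeSeq_mul, ih, Multiset.map_cons, Multiset.sum_cons]

theorem blockRed_eq (u : Associates H) :
    blockRed φ ι u = (primeSeq φ u).map (primeClass φ ι) := by
  obtain ⟨a, rfl⟩ := Associates.mk_surjective u
  rfl

theorem primeSeq_injective (hdiv : IsDivisorHom φ) : Function.Injective (primeSeq φ) := by
  intro u v h
  obtain ⟨a, rfl⟩ := Associates.mk_surjective u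
  obtain ⟨b, rfl⟩ := Associates.mk_surjective v
  have h' : φ a = φ b := h
  obtain ⟨c, rfl⟩ := hdiv a b h'.dvd
  obtain ⟨d, hd⟩ := hdiv (a * c) a h'.symm.dvd
  have hcd : c * d = 1 := by
    rw [mul_assoc] at hd
    exact mul_eq_left.mp hd.symm
  exact Associates.mk_eq_mk_iff_associated.mpr
    ⟨⟨c, d, hcd, (mul_comm d c).trans hcd⟩, rfl⟩

theorem sum_map_primeClass (X : Multiset P) :
    (X.map (primeClass φ ι)).sum = (ι (cls φ (Multiplicative.ofAdd X))).toAdd := by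
  have hmul : ∀ x y, cls φ (x * y) = cls φ x * cls φ y := fun x y => by
    simp only [cls, map_mul, QuotientGroup.mk_mul]
  induction X using Multiset.induction with
  | empty =>
    have h1 : cls φ (Multiplicative.ofAdd 0) = 1 := by
      have h2 := hmul 1 1
      rw [mul_one] at h2
      exact (mul_eq_left.mp h2.symm)
    rw [h1, map_one]
    rfl
  | cons p X ih =>
    rw [Multiset.map_cons, Multiset.sum_cons, ih, primeClass, ← toAdd_mul, ← map_mul, ← hmul,
      ← ofAdd_add, Multiset.singleton_add]

theorem primeSeq_mem_zeroWeight (u : Associates H) :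
    primeSeq φ u ∈ zeroWeight (primeClass φ ι) := by
  obtain ⟨a, rfl⟩ := Associates.mk_surjective u
  rw [mem_zeroWeight, sum_map_primeClass, primeSeq_mk, ofAdd_toAdd]
  have h1 : cls φ (φ a) = 1 := by
    rw [cls, QuotientGroup.eq_one_iff]
    exact Subgroup.subset_closure ⟨a, rfl⟩
  rw [h1, map_one]
  rfl

/-- Elements of `q(φ(H))` are quotients `φ a / φ b`. A sequence `X` of trivial class thus satisfies
`X · φ b = φ a`; the divisor property gives `a = b * c`, and cancellation gives `X = φ c`. -/
theorem exists_primeSeq_eq (hdiv : IsDivisorHom φ) {X : Multiset P}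
    (hX : X ∈ zeroWeight (primeClass φ ι)) : ∃ u, primeSeq φ u = X := by
  rw [mem_zeroWeight, sum_map_primeClass] at hX
  have h1 : cls φ (Multiplicative.ofAdd X) = 1 := by
    rw [← map_eq_one_iff ι ι.injective]
    exact Multiplicative.toAdd.injective hX
  rw [cls, QuotientGroup.eq_one_iff] at h1
  have h2 : ∀ x ∈ Subgroup.closure (Set.range fun a : H => Algebra.GrothendieckGroup.of (φ a)),
      ∃ a b : H, x * Algebra.GrothendieckGroup.of (φ b) = Algebra.GrothendieckGroup.of (φ a) := by
    intro x hx
    induction hx using Subgroup.closure_induction with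
    | mem x hx =>
      obtain ⟨a, rfl⟩ := hx
      exact ⟨a, 1, by simp⟩
    | one => exact ⟨1, 1, by simp⟩
    | mul x y _ _ hx hy =>
      obtain ⟨a, b, h⟩ := hx
      obtain ⟨c, d, h'⟩ := hy
      refine ⟨a * c, b * d, ?_⟩
      rw [map_mul, map_mul, map_mul, map_mul, ← h, ← h']
      exact mul_mul_mul_comm _ _ _ _
    | inv x _ hx =>
      obtain ⟨a, b, h⟩ := hx
      exact ⟨b, a, by rw [← h, inv_mul_cancel_left]⟩
  obtain ⟨a, b, hab⟩ := h2 _ h1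
  rw [← map_mul] at hab
  have h3 := Algebra.GrothendieckGroup.of_injective hab
  obtain ⟨c, rfl⟩ := hdiv b a ⟨_, h3.symm.trans (mul_comm _ _)⟩
  refine ⟨Associates.mk c, ?_⟩
  rw [map_mul, mul_comm] at h3
  have h4 : X = (φ c).toAdd := congrArg Multiplicative.toAdd (mul_left_cancel h3)
  exact h4.symm

/-- By injectivity and `exists_primeSeq_eq`, `primeSeq` is an isomorphism of `H_red` onto
`zeroWeight`, and so it preserves atoms. -/
theorem irreducible_iff_primeSeq_mem_atoms (hdiv : IsDivisorHom φ) (u : Associates H) :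
    Irreducible u ↔ primeSeq φ u ∈ atoms (zeroWeight (primeClass φ ι)) := by
  have hinj := primeSeq_injective φ hdiv
  have h1 : ∀ v, primeSeq φ v = 0 ↔ v = 1 := fun v => by
    rw [← primeSeq_one φ, hinj.eq_iff]
  rw [mem_atoms_iff (saturated_zeroWeight _), irreducible_iff, Associates.isUnit_iff_eq_one]
  constructor
  · rintro ⟨hu, h⟩
    refine ⟨primeSeq_mem_zeroWeight φ ι u, fun h0 => hu ((h1 u).mp h0), fun Y hY hle => ?_⟩
    obtain ⟨C, hC⟩ := Multiset.le_iff_exists_add.mp hle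
    have hCz := saturated_zeroWeight _ Y C hY (hC ▸ primeSeq_mem_zeroWeight φ ι u)
    obtain ⟨a, rfl⟩ := exists_primeSeq_eq φ ι hdiv hY
    obtain ⟨b, rfl⟩ := exists_primeSeq_eq φ ι hdiv hCz
    rw [← primeSeq_mul] at hC
    rcases h (hinj hC) with h | h <;> rw [Associates.isUnit_iff_eq_one] at h
    · exact Or.inl ((h1 a).mpr h)
    · right
      rw [hinj hC, h, mul_one]
  · rintro ⟨-, hu, h⟩
    refine ⟨fun h0 => hu ((h1 u).mpr h0), fun a b hab => ?_⟩
    rw [Associates.isUnit_iff_eq_one, Associates.isUnit_iff_eq_one]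
    have hle : primeSeq φ a ≤ primeSeq φ u := by
      rw [hab, primeSeq_mul]
      exact Multiset.le_add_right _ _
    rcases h _ (primeSeq_mem_zeroWeight φ ι a) hle with h | h
    · exact Or.inl ((h1 a).mp h)
    · right
      rw [hab, primeSeq_mul] at h
      exact (h1 b).mp (by simpa using h)

theorem blockFact_eq (z : Multiset (Associates H)) :
    blockFact φ ι z = (z.map (primeSeq φ)).map (Multiset.map (primeClass φ ι)) := by
  rw [blockFact, Multiset.map_map]
  exact Multiset.map_congr rfl fun u _ => blockRed_eq φ ι u

theorem posFact_blockFact (z : Multiset (Associates H)) :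
    posFact (blockFact φ ι z) = posOf (primeClass φ ι) (z.map (primeSeq φ)) := by
  rw [blockFact_eq, posOf_eq]

theorem mem_factorizations_iff (hdiv : IsDivisorHom φ) (a : H) (z : Multiset (Associates H)) :
    z ∈ factorizations a ↔
      (∀ U ∈ z.map (primeSeq φ), U ∈ atoms (zeroWeight (primeClass φ ι))) ∧
        (z.map (primeSeq φ)).sum = (φ a).toAdd := by
  refine and_congr ?_ ?_
  · simp only [Multiset.mem_map, forall_exists_index, and_imp, forall_apply_eq_imp_iff₂]
    exact forall₂_congr fun u _ => irreducible_iff_primeSeq_mem_atoms φ ι hdiv u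
  · rw [← primeSeq_prod, ← primeSeq_mk, (primeSeq_injective φ hdiv).eq_iff]

theorem mem_upsilon_iff (hdiv : IsDivisorHom φ) (a : H) (z : Multiset (Associates H)) :
    z ∈ upsilon φ ι a ↔
      z ∈ factorizations a ∧ IsMaxPos (primeClass φ ι) (z.map (primeSeq φ)) := by
  refine and_congr_right fun hz => ?_
  obtain ⟨h1, h2⟩ := (mem_factorizations_iff φ ι hdiv a z).mp hz
  have h3 : (z.map (primeSeq φ)).sum.map (primeClass φ ι) = block φ ι a := by
    rw [h2]
    rfl
  have h4 := map_mem_seqFactorizations h1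
  rw [h3, ← blockFact_eq] at h4
  constructor
  · intro h y hy hle
    rw [← posFact_blockFact] at hle ⊢
    rw [h3] at hy
    exact h.2 y hy hle
  · intro h
    refine ⟨h4, fun y hy hle => ?_⟩
    rw [posFact_blockFact] at hle ⊢
    exact h y (by rw [h3]; exact hy) hle

/-- The factorization in `H_red` that belongs to a factorization in `ℱ(P)`. -/
noncomputable def liftFact (z : Multiset (Multiset P)) : Multiset (Associates H) :=
  z.map (Function.invFun (primeSeq φ))

theorem liftFact_map (hdiv : IsDivisorHom φ) (z : Multiset (Associates H)) :
    liftFact φ (z.map (primeSeq φ)) = z := by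
  rw [liftFact, Multiset.map_map, (Function.invFun_comp (primeSeq_injective φ hdiv)),
    Multiset.map_id]

theorem map_liftFact (hdiv : IsDivisorHom φ) {z : Multiset (Multiset P)}
    (hz : ∀ U ∈ z, U ∈ atoms (zeroWeight (primeClass φ ι))) :
    (liftFact φ z).map (primeSeq φ) = z := by
  rw [liftFact, Multiset.map_map]
  conv_rhs => rw [← Multiset.map_id z]
  exact Multiset.map_congr rfl fun U hU =>
    Function.invFun_eq (exists_primeSeq_eq φ ι hdiv (hz U hU).1)

theorem dist_liftFact_le (z z' : Multiset (Multiset P)) :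
    dist (liftFact φ z) (liftFact φ z') ≤ dist z z' :=
  dist_map_le _ _ _

/-- Whatever the sign of the minimum, it is at least minus its absolute value; nothing more about
`M` is needed. -/
theorem neg_minSupp_le {a : H} {g : ℤ} (hg : g ∈ block φ ι a) :
    -(minSupp φ ι a : ℤ) ≤ g := by
  classical
  have hbdd : BddBelow {g : ℤ | g ∈ block φ ι a} :=
    ((block φ ι a).toFinset.finite_toSet.subset fun x hx => by simpa using hx).bddBelow
  have h1 : sInf {g : ℤ | g ∈ block φ ι a} ≤ g := csInf_le hbdd hg
  unfold minSupp
  omega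

theorem exists_davenportSE_eq (hfin : (negPart (primeClasses φ ι)).Finite) :
    ∃ D : ℕ, davenportSE φ ι = D ∧ DavenportBound (negPart (Set.range (primeClass φ ι))) D :=
  exists_relDavenport_bound (saturated_equalSumPairs _) (isPWO_equalSumPairs hfin)

end Transfer

end KrullChain

/-! ### The theorem for factorizations in `H`. -/

theorem mainTheorem5 {H P : Type*} [CancelCommMonoid H]
    (φ : H →* Multiplicative (Multiset P))
    (hdiv : KrullChain.IsDivisorHom φ) (hcof : KrullChain.IsCofinalHom φ)
    (ι : KrullChain.ClassGp φ ≃* Multiplicative ℤ)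
    (hfin : (KrullChain.negPart (KrullChain.primeClasses φ ι)).Finite)
    (a : H) :
    (max ((KrullChain.minSupp φ ι a : ℕ∞) * KrullChain.davenportSE φ ι) 2 < ⊤ ∧
      ∀ z ∈ KrullChain.factorizations a, ∃ y ∈ KrullChain.upsilon φ ι a,
        ∃ (r : ℕ) (c : ℕ → Multiset (Associates H)),
          c 0 = z ∧ c r = y ∧
          (∀ i ≤ r, c i ∈ KrullChain.factorizations a) ∧
          ∀ i < r,
            Multiset.card (c i) ≤ Multiset.card (c (i + 1)) ∧
            (KrullChain.dist (c i) (c (i + 1)) : ℕ∞) ≤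
              max ((KrullChain.minSupp φ ι a : ℕ∞) * KrullChain.davenportSE φ ι) 2 ∧
            KrullChain.PosLE (KrullChain.posFact (KrullChain.blockFact φ ι (c i)))
              (KrullChain.posFact (KrullChain.blockFact φ ι (c (i + 1))))) ∧
    (max (KrullChain.davenportSE φ ι) 2 < ⊤ ∧
      ∀ z ∈ KrullChain.upsilon φ ι a, ∀ y ∈ KrullChain.upsilon φ ι a,
        KrullChain.posFact (KrullChain.blockFact φ ι z) =
          KrullChain.posFact (KrullChain.blockFact φ ι y) →
        ∃ (r : ℕ) (c : ℕ → Multiset (Associates H)),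
          c 0 = z ∧ c r = y ∧
          (∀ i ≤ r, c i ∈ KrullChain.factorizations a ∧
            KrullChain.posFact (KrullChain.blockFact φ ι (c i)) =
              KrullChain.posFact (KrullChain.blockFact φ ι z) ∧
            Multiset.card (c i) = Multiset.card z ∧
            Multiset.card (c i) = Multiset.card y) ∧
          ∀ i < r, (KrullChain.dist (c i) (c (i + 1)) : ℕ∞) ≤
            max (KrullChain.davenportSE φ ι) 2) := by
  open KrullChain in
  obtain ⟨D, hD, hDb⟩ := exists_davenportSE_eq φ ι hfin
  rw [hD]
  have hcard : ∀ z : Multiset (Associates H), Multiset.card (z.map (primeSeq φ)) =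
    Multiset.card z := fun z => Multiset.card_map _ _
  refine ⟨⟨?_, fun z hz => ?_⟩, ?_, fun z hz y hy hzy => ?_⟩
  · refine max_lt ?_ ?_
    · exact_mod_cast ENat.natCast_lt_top (minSupp φ ι a * D)
    · exact ENat.natCast_lt_top 2
  · obtain ⟨hza, hzs⟩ := (mem_factorizations_iff φ ι hdiv a z).mp hz
    obtain ⟨y, hchain, hya, hys, hmax⟩ := exists_chain_to_isMaxPos (M := minSupp φ ι a) hDb hza
      (fun g hg _ => neg_minSupp_le φ ι (a := a) (by rw [hzs] at hg; exact hg))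
    obtain ⟨r, c, hc0, hcr, hc⟩ := exists_chain_function hchain
    have hca : ∀ i ≤ r, (∀ U ∈ c i, U ∈ atoms (zeroWeight (primeClass φ ι))) ∧
        (c i).sum = (φ a).toAdd := by
      intro i
      induction i with
      | zero => exact fun _ => by rw [hc0]; exact ⟨hza, hzs⟩
      | succ i ih =>
        intro hi
        have h := hc i (by omega)
        exact ⟨h.1, h.2.1.trans (ih (by omega)).2⟩
    have hcl : ∀ i ≤ r, (liftFact φ (c i)).map (primeSeq φ) = c i := fun i hi =>
      map_liftFact φ ι hdiv (hca i hi).1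
    have hcf : ∀ i ≤ r, liftFact φ (c i) ∈ factorizations a := fun i hi => by
      rw [mem_factorizations_iff φ ι hdiv, hcl i hi]
      exact hca i hi
    refine ⟨liftFact φ y, ?_, r, fun i => liftFact φ (c i), ?_, congrArg (liftFact φ) hcr, hcf,
      fun i hi => ⟨?_, ?_, ?_⟩⟩
    · rw [mem_upsilon_iff φ ι hdiv, ← hcr, hcl r le_rfl, hcr]
      exact ⟨hcr ▸ hcf r le_rfl, hmax⟩
    · simp only [hc0]
      exact liftFact_map φ hdiv z
    · simp only [liftFact, Multiset.card_map]
      exact (hc i hi).2.2.1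
    -- The steps of this chain already satisfy the bound `M * D`.
    · refine le_trans ?_ (le_max_left _ _)
      exact_mod_cast (dist_liftFact_le φ _ _).trans (hc i hi).2.2.2.1
    · rw [posFact_blockFact, posFact_blockFact, hcl i hi.le, hcl (i + 1) hi]
      exact (hc i hi).2.2.2.2
  · exact max_lt (ENat.natCast_lt_top D) (ENat.natCast_lt_top 2)
  · obtain ⟨hzf, hzm⟩ := (mem_upsilon_iff φ ι hdiv a z).mp hz
    obtain ⟨hza, hzs⟩ := (mem_factorizations_iff φ ι hdiv a z).mp hzf
    obtain ⟨hya, hys⟩ := (mem_factorizations_iff φ ι hdiv a y).mp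
      ((mem_upsilon_iff φ ι hdiv a y).mp hy).1
    rw [posFact_blockFact, posFact_blockFact] at hzy
    obtain ⟨r, c, hc0, hcr, hc⟩ := exists_chain_function
      (exists_chain_of_isMaxPos hDb hza hya (hzs.trans hys.symm) hzy hzm)
    have hca : ∀ i ≤ r, (∀ U ∈ c i, U ∈ atoms (zeroWeight (primeClass φ ι))) ∧
        (c i).sum = (φ a).toAdd ∧
        posOf (primeClass φ ι) (c i) = posOf (primeClass φ ι) (z.map (primeSeq φ)) := by
      intro i
      induction i with
      | zero => exact fun _ => by rw [hc0]; exact ⟨hza, hzs, rfl⟩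
      | succ i ih =>
        intro hi
        have h := hc i (by omega)
        exact ⟨h.1, h.2.1.trans (ih (by omega)).2.1, h.2.2.1.trans (ih (by omega)).2.2⟩
    have hcl : ∀ i ≤ r, (liftFact φ (c i)).map (primeSeq φ) = c i := fun i hi =>
      map_liftFact φ ι hdiv (hca i hi).1
    refine ⟨r, fun i => liftFact φ (c i), ?_, ?_, fun i hi => ⟨?_, ?_, ?_, ?_⟩, fun i hi => ?_⟩
    · simp only [hc0]
      exact liftFact_map φ hdiv z
    · simp only [hcr]
      exact liftFact_map φ hdiv y
    · rw [mem_factorizations_iff φ ι hdiv, hcl i hi]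
      exact ⟨(hca i hi).1, (hca i hi).2.1⟩
    · rw [posFact_blockFact, posFact_blockFact, hcl i hi]
      exact (hca i hi).2.2
    · rw [← hcard z, ← card_eq_of_posOf_eq (hca i hi).2.2]
      exact Multiset.card_map _ _
    · rw [← hcard y, ← card_eq_of_posOf_eq ((hca i hi).2.2.trans hzy)]
      exact Multiset.card_map _ _
    · have h := (dist_liftFact_le φ _ _).trans (hc i hi).2.2.2
      rcases le_max_iff.mp h with h | h
      · exact le_max_of_le_left (Nat.cast_le.mpr h)
      · exact le_max_of_le_right (Nat.cast_le.mpr h)
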